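/- All graphs are finite, simple and undirected. A tree decomposition of a graph $G=(V,E)$ is a pair $(T,\{B_x\}_{x\in V(T)})$, where $T$ is a (finite) tree and the bags $B_x$ are subsets of $V$, such that every vertex of $G$ lies in some bag, the two ends of every edge of $G$ lie together in some bag, and for each $v\in V$ the nodes $x$ with $v\in B_x$ induce a subtree of $T$. Its width is $\max_x |B_x|-1$. The pathwidth of $G$ is the minimum width of a tree decomposition of $G$ whose tree is a path. A directed spaghetti tree decomposition of $G$ is a tree decomposition in which every edge of $T$ is given one direction and, for each $v\in V$, the nodes $x$ with $v\in B_x$ induce a directed path in $T$. The directed spaghetti treewidth of $G$ is the minimum width of a directed spaghetti tree decomposition of $G$. A graph is $2$-connected if it has at least three vertices and remains connected after the deletion of any set of at most one vertex. A cut vertex of a connected graph is a vertex whose deletion disconnects it. A block of $G$ is a maximal connected subgraph of $G$ without a cut vertex (of its own). A mamba is a graph that is either a $2$-connected graph of pathwidth two, or a single edge, or an isolated vertex. Let $K_4$ be the complete graph on four vertices, let $D_3$ be the graph that consists of two vertices and three internally vertex-disjoint paths of length three between them, and let $S_3$ be the $3$-sun, i.e. the graph obtained from a cycle $v_1v_2v_3v_4v_5v_6v_1$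 by adding the edges $v_2v_4$, $v_4v_6$, $v_6v_2$. **Theorem.** Let $G$ be a finite graph. The following are equivalent. 1. $G$ has directed spaghetti treewidth at most two. 2. Each block of $G$ is a mamba. 3. $G$ has no minor isomorphic to $K_4$, $D_3$ or $S_3$. -/

import Mathlib

namespace GraphWidth

variable {V W ι : Type*}

/-- The set `S` of nodes of the digraph `D` induces a directed path (with at least one node). -/
def InducesDirectedPath (D : Digraph ι) (S : Set ι) : Prop :=
  ∃ (m : ℕ) (p : Fin (m + 1) → ι), Function.Injective p ∧ Set.range p = S ∧
    ∀ i j : Fin (m + 1), D.Adj (p i) (p j) ↔ (i : ℕ) + 1 = (j : ℕ)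

/-- The undirected graph `T` is a path (with at least one node). -/
def IsPathGraph (T : SimpleGraph ι) : Prop :=
  ∃ m : ℕ, Nonempty (T ≃g SimpleGraph.pathGraph (m + 1))

/-- A tree decomposition of `G` over the tree `T`. -/
structure TreeDecomposition (G : SimpleGraph V) (T : SimpleGraph ι) where
  isTree : T.IsTree
  bag : ι → Set V
  exists_mem_bag : ∀ v : V, ∃ x, v ∈ bag x
  exists_adj_mem_bag : ∀ u v : V, G.Adj u v → ∃ x, u ∈ bag x ∧ v ∈ bag x
  isTree_induce : ∀ v : V, (T.induce {x | v ∈ bag x}).IsTree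

/-- The width: the maximum size of a bag, minus one. (The subtraction truncates only for empty
bags, hence it affects the maximum only when `V` is empty; that width is then `0`.) -/
noncomputable def TreeDecomposition.width {G : SimpleGraph V} {T : SimpleGraph ι}
    (I : TreeDecomposition G T) : ℕ∞ :=
  ⨆ x, ((I.bag x).encard - 1)

/-- A directed spaghetti tree decomposition of `G` over the directed tree `D`: the underlying
graph of `D` is a tree, each edge of it has exactly one direction in `D`, and for each vertex of
`G` the bags containing it induce a directed path in `D`. -/
structure DirectedSpaghettiTreeDecomposition (G : SimpleGraph V) (D : Digraph ι) extends
    TreeDecomposition G D.toSimpleGraphInclusive where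
  asymm : ∀ x y, D.Adj x y → ¬ D.Adj y x
  inducesDirectedPath : ∀ v : V, InducesDirectedPath D {x | v ∈ bag x}

/-- The directed spaghetti treewidth: the minimum width of a directed spaghetti tree decomposition
over a finite directed tree. -/
noncomputable def directedSpaghettiTreewidth (G : SimpleGraph V) : ℕ∞ :=
  ⨅ (n : ℕ) (D : Digraph (Fin n)) (I : DirectedSpaghettiTreeDecomposition G D),
    I.toTreeDecomposition.width

/-- The pathwidth: the minimum width of a tree decomposition over a finite path. -/
noncomputable def pathwidth (G : SimpleGraph V) : ℕ∞ :=
  ⨅ (n : ℕ) (T : SimpleGraph (Fin n)) (_ : IsPathGraph T) (I : TreeDecomposition G T), I.width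

/-- `v` is a cut vertex of the connected graph `G`. Deleting the only vertex of a one-vertex graph
leaves the empty graph, which does not count as disconnected here. -/
def IsCutVertex (G : SimpleGraph V) (v : V) : Prop :=
  G.Connected ∧ ¬ (G.induce ({v}ᶜ : Set V)).Preconnected

/-- A block: a maximal connected subgraph that has no cut vertex (of its own). -/
def IsBlock (G : SimpleGraph V) (B : G.Subgraph) : Prop :=
  Maximal (fun H : G.Subgraph => H.coe.Connected ∧ ∀ v, ¬ IsCutVertex H.coe v) B

/-- `G` is 2-connected. -/
def TwoConnected (G : SimpleGraph V) : Prop :=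
  3 ≤ ENat.card V ∧ ∀ X : Set V, X.encard ≤ 1 → (G.induce Xᶜ).Connected

/-- A mamba: a 2-connected graph of pathwidth two, or a single edge, or an isolated vertex. -/
def IsMamba (G : SimpleGraph V) : Prop :=
  (TwoConnected G ∧ pathwidth G = 2) ∨
    Nonempty (G ≃g SimpleGraph.completeGraph (Fin 2)) ∨
    Nonempty (G ≃g SimpleGraph.completeGraph (Fin 1))

/-- `G` has a minor isomorphic to `H`: there are disjoint connected branch sets in `G`, one for
each vertex of `H`, with an edge of `G` between any two that belong to adjacent vertices. -/
def HasMinor (G : SimpleGraph V) (H : SimpleGraph W) : Prop :=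
  ∃ B : W → Set V, (∀ w, (G.induce (B w)).Connected) ∧
    (∀ w w', w ≠ w' → Disjoint (B w) (B w')) ∧
    ∀ w w', H.Adj w w' → ∃ x ∈ B w, ∃ y ∈ B w', G.Adj x y

/-- The complete graph on four vertices. -/
def K4 : SimpleGraph (Fin 4) := SimpleGraph.completeGraph (Fin 4)

/-- Two vertices `0`, `1` joined by three internally disjoint paths of length three. -/
def D3 : SimpleGraph (Fin 8) :=
  SimpleGraph.fromEdgeSet
    {s(0, 2), s(2, 3), s(3, 1), s(0, 4), s(4, 5), s(5, 1), s(0, 6), s(6, 7), s(7, 1)}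

/-- The 3-sun: the cycle `0 1 2 3 4 5` together with the triangle `1 3 5`. -/
def S3 : SimpleGraph (Fin 6) :=
  SimpleGraph.fromEdgeSet
    {s(0, 1), s(1, 2), s(2, 3), s(3, 4), s(4, 5), s(5, 0), s(1, 3), s(3, 5), s(5, 1)}

end GraphWidth

/-! Width at most two means that no bag has more than three vertices, so no bag meets four disjoint
branch sets.

From 1 to 3: the nodes whose bags meet a connected vertex set form a subtree, and pairwise meeting
subtrees have a common node (`helly_three`, `helly_four`). For `K4` this already gives a bag with
four vertices. For `S3`, the bags that meet all three sets of the central triangle contain the same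
three vertices. Each outer branch set forces an exit from this region which two of the three
vertices take together. A directed path has one way in and one way out, so exits that share a vertex
have opposite orientations, which is impossible for three pairwise sharing exits. For `D3`, the
median of three exits is a node at which a single vertex would have to continue into three
neighbours (`not_theta`).

From 3 to 2: a block with at least three vertices is 2-connected, and it remains to lay it out along
a path (`TwoConnected.intervalsOn`). If all degrees are at most two, this is a direct sweep.
Otherwise some pair `x`, `y` is joined by three legs, and excluding `K4` puts the legs into
different components of `G - {x, y}` (`exists_isThetaPair`). Seen from one component, the rest
supplies a triangle through `x` and `y` (`Flank`). Excluding `K4` and `S3` leaves `x` or `y` with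
only one neighbour in the component; this neighbour is peeled off, and excluding `D3` keeps the
recursion from branching (`Flank.sweepOn`). `D3` also bounds by two the number of components with
more than one vertex, so two sweeps that meet in `{x, y}` cover everything.

From 2 to 1: a mamba has a path decomposition of width at most two, which becomes a directed
spaghetti decomposition when the path is directed. Two decompositions that share one vertex `v` are
joined by an arc from the end of the path of `v` in one to its start in the other
(`SpaghettiOn.union`); induction over cut vertices and components assembles `G`. -/

namespace GraphWidth

/-! ### Connected vertex sets, described by cuts -/

section Connectivity

variable {V : Type*} {G : SimpleGraph V}

/-- The vertex set `S` induces a connected subgraph of `G`. -/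
def ConnOn (G : SimpleGraph V) (S : Set V) : Prop := (G.induce S).Connected

lemma ConnOn.nonempty {S : Set V} (h : ConnOn G S) : S.Nonempty := by
  obtain ⟨x⟩ := SimpleGraph.Connected.nonempty h
  exact ⟨x, x.2⟩

lemma ConnOn.exists_adj {S P : Set V} (h : ConnOn G S) {a b : V} (ha : a ∈ S) (haP : a ∈ P)
    (hb : b ∈ S) (hbP : b ∉ P) : ∃ u ∈ S, u ∈ P ∧ ∃ v ∈ S, v ∉ P ∧ G.Adj u v := by
  obtain ⟨p⟩ := h.preconnected ⟨a, ha⟩ ⟨b, hb⟩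
  obtain ⟨d, -, h1, h2⟩ := p.exists_boundary_dart (Subtype.val ⁻¹' P) haP hbP
  exact ⟨_, d.fst.2, h1, _, d.snd.2, h2, d.adj⟩

/-- The converse of `ConnOn.exists_adj`. Connectivity as "every cut is crossed by an edge" replaces
walks in most of what follows. -/
lemma connOn_of_forall_exists_adj {S : Set V} (h0 : S.Nonempty)
    (h : ∀ P : Set V, ∀ a ∈ S, a ∈ P → ∀ b ∈ S, b ∉ P →
      ∃ u ∈ S, u ∈ P ∧ ∃ v ∈ S, v ∉ P ∧ G.Adj u v) : ConnOn G S := by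
  have : Nonempty S := h0.to_subtype
  refine SimpleGraph.Connected.mk fun a b => ?_
  by_contra hab
  obtain ⟨u, hu, ⟨hu', hr⟩, v, hv, hv', huv⟩ := h {w | ∃ hw : w ∈ S, (G.induce S).Reachable a ⟨w, hw⟩}
    a a.2 ⟨a.2, SimpleGraph.Reachable.refl _⟩ b b.2 fun ⟨_, hr⟩ => hab hr
  exact hv' ⟨hv, hr.trans (SimpleGraph.Adj.reachable (by simpa using huv))⟩

lemma connOn_singleton (v : V) : ConnOn G {v} :=
  connOn_of_forall_exists_adj ⟨v, rfl⟩ fun P a ha haP b hb hbP => by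
    rw [Set.mem_singleton_iff] at ha hb; subst ha; subst hb; exact absurd haP hbP

lemma ConnOn.union {S T : Set V} (hS : ConnOn G S) (hT : ConnOn G T) (h : (S ∩ T).Nonempty) :
    ConnOn G (S ∪ T) := by
  obtain ⟨c, hcS, hcT⟩ := h
  refine connOn_of_forall_exists_adj ⟨c, Or.inl hcS⟩ fun P a ha haP b hb hbP => ?_
  have key : ∀ U, (U = S ∨ U = T) → ∀ a ∈ U, a ∈ P → ∀ b ∈ U, b ∉ P →
      ∃ u ∈ S ∪ T, u ∈ P ∧ ∃ v ∈ S ∪ T, v ∉ P ∧ G.Adj u v := by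
    rintro U hU a ha haP b hb hbP
    have hUc : ConnOn G U := by rcases hU with rfl | rfl <;> assumption
    have hUs : U ⊆ S ∪ T := by rcases hU with rfl | rfl <;> simp
    obtain ⟨u, hu, hu', v, hv, hv', huv⟩ := hUc.exists_adj ha haP hb hbP
    exact ⟨u, hUs hu, hu', v, hUs hv, hv', huv⟩
  by_cases hcP : c ∈ P
  · rcases hb with hb | hb
    · exact key S (.inl rfl) c hcS hcP b hb hbP
    · exact key T (.inr rfl) c hcT hcP b hb hbP
  · rcases ha with ha | ha
    · exact key S (.inl rfl) a ha haP c hcS hcP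
    · exact key T (.inr rfl) a ha haP c hcT hcP

lemma connOn_pair {u v : V} (h : G.Adj u v) : ConnOn G {u, v} := by
  refine connOn_of_forall_exists_adj ⟨u, by simp⟩ fun P a ha haP b hb hbP => ?_
  refine ⟨a, ha, haP, b, hb, hbP, ?_⟩
  have hab : a ≠ b := fun h => hbP (h ▸ haP)
  rcases ha with rfl | rfl <;> rcases hb with rfl | rfl
  exacts [absurd rfl hab, h, h.symm, absurd rfl hab]

lemma ConnOn.union_adj {S T : Set V} (hS : ConnOn G S) (hT : ConnOn G T) {u v : V} (hu : u ∈ S)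
    (hv : v ∈ T) (h : G.Adj u v) : ConnOn G (S ∪ T) := by
  have h1 := (hS.union (connOn_pair h) ⟨u, hu, by simp⟩).union hT ⟨v, by simp, hv⟩
  convert h1 using 1
  ext w
  simp only [Set.mem_union, Set.mem_insert_iff, Set.mem_singleton_iff]
  constructor
  · tauto
  · rintro ((h | rfl | rfl) | h) <;> tauto

lemma ConnOn.insert {S : Set V} (hS : ConnOn G S) {u v : V} (hu : u ∈ S) (h : G.Adj v u) :
    ConnOn G (insert v S) := by
  rw [Set.insert_eq]
  exact (connOn_singleton v).union_adj hS rfl hu h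

lemma connOn_of_forall_mem {S : Set V} {a : V} (ha : a ∈ S)
    (h : ∀ w ∈ S, ∃ K ⊆ S, ConnOn G K ∧ a ∈ K ∧ w ∈ K) : ConnOn G S := by
  refine connOn_of_forall_exists_adj ⟨a, ha⟩ fun P b hb hbP c hc hcP => ?_
  have key : ∀ w ∈ S, ¬ (w ∈ P ↔ a ∈ P) → ∃ u ∈ S, u ∈ P ∧ ∃ v ∈ S, v ∉ P ∧ G.Adj u v := by
    intro w hw hwa
    obtain ⟨K, hKS, hK, haK, hwK⟩ := h w hw
    by_cases haP : a ∈ P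
    · obtain ⟨u, hu, hu', v, hv, hv', huv⟩ := hK.exists_adj haK haP hwK (by tauto)
      exact ⟨u, hKS hu, hu', v, hKS hv, hv', huv⟩
    · obtain ⟨u, hu, hu', v, hv, hv', huv⟩ := hK.exists_adj hwK (by tauto) haK haP
      exact ⟨u, hKS hu, hu', v, hKS hv, hv', huv⟩
  by_cases haP : a ∈ P
  · exact key c hc (by tauto)
  · exact key b hb (by tauto)

/-- The component of `v` in the subgraph induced by `U`; empty if `v ∉ U`. -/
def compOn (G : SimpleGraph V) (U : Set V) (v : V) : Set V :=
  {w | ∃ K ⊆ U, ConnOn G K ∧ v ∈ K ∧ w ∈ K}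

variable {U K : Set V} {u v w : V}

lemma compOn_subset : compOn G U v ⊆ U := fun _ ⟨_, hK, _, _, hw⟩ => hK hw

lemma mem_compOn_self (hv : v ∈ U) : v ∈ compOn G U v :=
  ⟨{v}, by simpa, connOn_singleton v, rfl, rfl⟩

lemma connOn_compOn (hv : v ∈ U) : ConnOn G (compOn G U v) :=
  connOn_of_forall_mem (mem_compOn_self hv) fun _ ⟨K, hKU, hK, hvK, hwK⟩ =>
    ⟨K, fun _ hu => ⟨K, hKU, hK, hvK, hu⟩, hK, hvK, hwK⟩

lemma ConnOn.subset_compOn (hK : ConnOn G K) (hKU : K ⊆ U) (hu : u ∈ K) (huv : u ∈ compOn G U v) :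
    K ⊆ compOn G U v := by
  obtain ⟨K', hK'U, hK', hvK', huK'⟩ := huv
  exact fun w hw => ⟨K ∪ K', Set.union_subset hKU hK'U, hK.union hK' ⟨u, hu, huK'⟩, .inr hvK', .inl hw⟩

lemma mem_compOn_of_adj (hu : u ∈ compOn G U v) (hw : w ∈ U) (h : G.Adj u w) : w ∈ compOn G U v :=
  (connOn_pair h).subset_compOn (U := U)
    (by rintro x (rfl | rfl); exacts [compOn_subset hu, hw]) (by simp) hu (by simp)

lemma mem_compOn_symm (h : w ∈ compOn G U v) : v ∈ compOn G U w :=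
  let ⟨K, hKU, hK, hv, hw⟩ := h
  ⟨K, hKU, hK, hw, hv⟩

lemma mem_compOn_trans (h : v ∈ compOn G U u) (h' : w ∈ compOn G U v) : w ∈ compOn G U u :=
  let ⟨_, hKU, hK, hv, hw⟩ := h'
  hK.subset_compOn hKU hv h hw

lemma compOn_eq_of_mem (h : w ∈ compOn G U v) : compOn G U w = compOn G U v :=
  Set.Subset.antisymm (fun _ h' => mem_compOn_trans h h')
    fun _ h' => mem_compOn_trans (mem_compOn_symm h) h'

/-- A component of the subgraph induced by a proper subset of a connected set sends an edge out
of that subset. -/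
lemma ConnOn.exists_adj_compOn (hK : ConnOn G K) (hUK : U ⊆ K) (hv : v ∈ U) (hw : w ∈ K)
    (hwU : w ∉ U) : ∃ a ∈ compOn G U v, ∃ b ∈ K, b ∉ U ∧ G.Adj a b := by
  obtain ⟨a, -, ha, b, hb, hb', hab⟩ := hK.exists_adj (P := compOn G U v) (hUK hv)
    (mem_compOn_self hv) hw fun h => hwU (compOn_subset h)
  exact ⟨a, ha, b, hb, fun h => hb' (mem_compOn_of_adj ha h hab), hab⟩

/-- Two disjoint connected subsets of a connected set extend to a partition of it into two
adjacent connected sets. -/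
lemma ConnOn.exists_split (hK : ConnOn G K) {A B : Set V} (hA : ConnOn G A) (hB : ConnOn G B)
    (hAK : A ⊆ K) (hBK : B ⊆ K) (hAB : Disjoint A B) :
    ∃ A' B', ConnOn G A' ∧ ConnOn G B' ∧ A ⊆ A' ∧ B ⊆ B' ∧ Disjoint A' B' ∧ A' ∪ B' = K ∧
      ∃ a ∈ A', ∃ b ∈ B', G.Adj a b := by
  obtain ⟨a, ha⟩ := hA.nonempty
  obtain ⟨b, hb⟩ := hB.nonempty
  have hBU : B ⊆ K \ A := fun x hx => ⟨hBK hx, fun h => Set.disjoint_left.1 hAB h hx⟩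
  have hbU := hBU hb
  set C := compOn G (K \ A) b with hC
  have hCA : ∀ x ∈ C, x ∉ A := fun x hx => (compOn_subset hx).2
  -- What remains after the removal of one component of `K \ A` is `A` together with the other
  -- components, each of which sends an edge to `A`.
  have hKC : ConnOn G (K \ C) := by
    refine connOn_of_forall_mem (a := a) ⟨hAK ha, fun h => hCA _ h ha⟩ fun w ⟨hwK, hwC⟩ => ?_
    by_cases hwA : w ∈ A
    · exact ⟨A, fun x hx => ⟨hAK hx, fun h => hCA _ h hx⟩, hA, ha, hwA⟩
    have hwU : w ∈ K \ A := ⟨hwK, hwA⟩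
    obtain ⟨c, hc, d, hd, hd', hcd⟩ := hK.exists_adj_compOn (U := K \ A) Set.sdiff_subset hwU
      (hAK ha) (fun h => h.2 ha)
    have hdA : d ∈ A := by
      by_contra h; exact hd' ⟨hd, h⟩
    refine ⟨compOn G (K \ A) w ∪ A, ?_, (connOn_compOn hwU).union_adj hA hc hdA hcd, .inr ha,
      .inl (mem_compOn_self hwU)⟩
    rintro x (hx | hx)
    · refine ⟨(compOn_subset hx).1, fun h => hwC ?_⟩
      exact mem_compOn_trans h (mem_compOn_symm hx)
    · exact ⟨hAK hx, fun h => hCA _ h hx⟩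
  obtain ⟨c, hc, d, hd, hd', hcd⟩ := hK.exists_adj_compOn (U := K \ A) Set.sdiff_subset hbU
      (hAK ha) (fun h => h.2 ha)
  have hdA : d ∈ A := by
    by_contra h; exact hd' ⟨hd, h⟩
  refine ⟨K \ C, C, hKC, connOn_compOn hbU, fun x hx => ⟨hAK hx, fun h => hCA _ h hx⟩,
    hB.subset_compOn hBU hb (mem_compOn_self hbU), Set.disjoint_sdiff_left, ?_, d,
    ⟨hd, fun h => hCA _ h hdA⟩, c, hc, hcd.symm⟩
  exact Set.sdiff_union_of_subset fun x hx => (compOn_subset hx).1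

lemma connOn_image {W : Type*} {H : SimpleGraph W} (f : W → V)
    (hf : ∀ a b, H.Adj a b → G.Adj (f a) (f b)) {S : Set W} (hS : ConnOn H S) :
    ConnOn G (f '' S) := by
  refine connOn_of_forall_exists_adj (hS.nonempty.image f) ?_
  rintro P _ ⟨a, ha, rfl⟩ haP _ ⟨b, hb, rfl⟩ hbP
  obtain ⟨u, hu, hu', v, hv, hv', huv⟩ := hS.exists_adj (P := f ⁻¹' P) ha haP hb hbP
  exact ⟨f u, ⟨u, hu, rfl⟩, hu', f v, ⟨v, hv, rfl⟩, hv', hf _ _ huv⟩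

lemma connOn_univ : ConnOn G Set.univ ↔ G.Connected := by
  constructor
  · intro h
    obtain ⟨x, -⟩ := h.nonempty
    have : Nonempty V := ⟨x⟩
    refine ⟨fun a b => ?_⟩
    obtain ⟨p⟩ := h.preconnected ⟨a, trivial⟩ ⟨b, trivial⟩
    exact ⟨p.map ⟨Subtype.val, fun h => h⟩⟩
  · intro h
    refine connOn_of_forall_exists_adj (@Set.univ_nonempty V h.nonempty)
      fun P a _ haP b _ hbP => ?_
    obtain ⟨p⟩ := h.preconnected a b
    obtain ⟨d, -, h1, h2⟩ := p.exists_boundary_dart P haP hbP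
    exact ⟨_, trivial, h1, _, trivial, h2, d.adj⟩

lemma connOn_iff_of_embedding {W : Type*} {H : SimpleGraph W} (f : H ↪g G) {S : Set W} :
    ConnOn H S ↔ ConnOn G (f '' S) := by
  refine ⟨connOn_image f fun a b h => f.map_adj_iff.2 h, fun h => ?_⟩
  refine connOn_of_forall_exists_adj (by simpa using h.nonempty) fun P a ha haP b hb hbP => ?_
  obtain ⟨_, ⟨u, hu, rfl⟩, ⟨u', hu', hu''⟩, _, ⟨v, hv, rfl⟩, hv', huv⟩ := h.exists_adj (P := f '' P)
    ⟨a, ha, rfl⟩ ⟨a, haP, rfl⟩ ⟨b, hb, rfl⟩ (fun ⟨c, hc, hcb⟩ => hbP (f.injective hcb ▸ hc))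
  exact ⟨u, hu, f.injective hu'' ▸ hu', v, hv, fun h => hv' ⟨v, h, rfl⟩, f.map_adj_iff.1 huv⟩

/-- A cut of the union that no edge crosses contains or misses each `S w` entirely, and hence is a
cut of `B` that no edge crosses. -/
lemma connOn_biUnion {W : Type*} {H : SimpleGraph W} {B : Set W} (hB : ConnOn H B) (S : W → Set V)
    (hS : ∀ w ∈ B, ConnOn G (S w)) (h : ∀ w ∈ B, ∀ w' ∈ B, H.Adj w w' → (S w ∩ S w').Nonempty) :
    ConnOn G (⋃ w ∈ B, S w) := by
  obtain ⟨w, hw⟩ := hB.nonempty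
  obtain ⟨x, hx⟩ := (hS w hw).nonempty
  refine connOn_of_forall_exists_adj ⟨x, Set.mem_biUnion hw hx⟩ fun P a ha haP b hb hbP => ?_
  by_contra hcon
  have key : ∀ w ∈ B, ∀ c ∈ S w, c ∈ P → S w ⊆ P := by
    intro w hw c hc hcP d hd
    by_contra hdP
    obtain ⟨u, hu, hu', v, hv, hv', huv⟩ := (hS w hw).exists_adj hc hcP hd hdP
    exact hcon ⟨u, Set.mem_biUnion hw hu, hu', v, Set.mem_biUnion hw hv, hv', huv⟩
  simp only [Set.mem_iUnion, exists_prop] at ha hb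
  obtain ⟨wa, hwa, ha⟩ := ha
  obtain ⟨wb, hwb, hb⟩ := hb
  obtain ⟨u, hu, hu', v, hv, hv', huv⟩ := hB.exists_adj (P := {w | S w ⊆ P}) hwa
    (key wa hwa a ha haP) hwb fun h => hbP (h hb)
  obtain ⟨c, hc, hc'⟩ := h u hu v hv huv
  exact hv' (key v hv c hc' (hu' hc))

/-- A connected set that contains two given vertices and is inclusion-minimal with this property. -/
lemma ConnOn.exists_minimal [Finite V] (hK : ConnOn G K) {a b : V} (ha : a ∈ K) (hb : b ∈ K) :
    ∃ M ⊆ K, Minimal (fun S => ConnOn G S ∧ a ∈ S ∧ b ∈ S) M := by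
  obtain ⟨M, hM, hM'⟩ := Set.Finite.exists_le_minimal (s := {S : Set V | ConnOn G S ∧ a ∈ S ∧ b ∈ S})
    (Set.toFinite _) ⟨hK, ha, hb⟩
  exact ⟨M, hM, hM'⟩

end Connectivity

/-! ### Subtrees of a forest and their Helly property -/

section Acyclic

variable {ι : Type*} {T : SimpleGraph ι}

/-- An edge that alone crosses some cut is a bridge. Together with the converse `exists_cut` this
expresses acyclicity by cuts. -/
lemma isAcyclic_of_cuts (h : ∀ u v, T.Adj u v →
    ∃ P : Set ι, u ∈ P ∧ v ∉ P ∧ ∀ a ∈ P, ∀ b ∉ P, T.Adj a b → a = u ∧ b = v) : T.IsAcyclic := by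
  rw [SimpleGraph.isAcyclic_iff_forall_adj_isBridge]
  intro u v huv
  obtain ⟨P, hu, hv, hP⟩ := h u v huv
  rw [SimpleGraph.isBridge_iff]
  rintro ⟨p⟩
  obtain ⟨d, -, h1, h2⟩ := p.exists_boundary_dart P hu hv
  have hd := d.adj
  rw [SimpleGraph.deleteEdges_adj] at hd
  obtain ⟨h3, h4⟩ := hP _ h1 _ h2 hd.1
  exact hd.2 (by simp [h3, h4])

lemma exists_cut (hT : T.IsAcyclic) {u v : ι} (h : T.Adj u v) :
    ∃ P : Set ι, u ∈ P ∧ v ∉ P ∧ ∀ a ∈ P, ∀ b ∉ P, T.Adj a b → a = u ∧ b = v := by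
  have hb := SimpleGraph.isAcyclic_iff_forall_adj_isBridge.1 hT h
  rw [SimpleGraph.isBridge_iff] at hb
  refine ⟨{w | (T.deleteEdges {s(u, v)}).Reachable u w}, SimpleGraph.Reachable.refl _, hb,
    fun a ha b hb' hab => ?_⟩
  by_contra hcon
  have hb'' : ¬ (T.deleteEdges {s(u, v)}).Reachable u b := hb'
  by_cases hs : s(a, b) = s(u, v)
  · rcases Sym2.eq_iff.1 hs with h1 | ⟨rfl, rfl⟩
    · exact hcon h1
    · exact hb ha
  · exact hb'' (ha.trans (SimpleGraph.Adj.reachable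
      ((SimpleGraph.deleteEdges_adj).2 ⟨hab, by simpa using hs⟩)))

/-- The edge `pq` is a bridge, and neither set contains both of its ends, so each stays on its own
side. All later tree arguments rest on this. -/
lemma disjoint_of_adj (hT : T.IsAcyclic) {p q : ι} (h : T.Adj p q) {K K' : Set ι}
    (hK : ConnOn T K) (hK' : ConnOn T K') (hp : p ∈ K) (hq : q ∉ K) (hq' : q ∈ K') (hp' : p ∉ K') :
    Disjoint K K' := by
  obtain ⟨P, hpP, hqP, hP⟩ := exists_cut hT h
  rw [Set.disjoint_left]
  intro x hx hx'
  by_cases hxP : x ∈ P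
  · obtain ⟨u, hu, hu', v, -, hv', huv⟩ := hK'.exists_adj hx' hxP hq' hqP
    exact hp' ((hP u hu' v hv' huv).1 ▸ hu)
  · obtain ⟨u, -, hu', v, hv, hv', huv⟩ := hK.exists_adj hp hpP hx hxP
    exact hq ((hP u hu' v hv' huv).2 ▸ hv)

/-- If the intersection had a second component, `S` would link it to the first one `M` through an
edge `qp` with `p ∈ M` and `q ∉ S'`. By `disjoint_of_adj`, `S'` cannot reach the part behind `q`. -/
lemma ConnOn.inter (hT : T.IsAcyclic) {S S' : Set ι} (hS : ConnOn T S) (hS' : ConnOn T S')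
    (h : (S ∩ S').Nonempty) : ConnOn T (S ∩ S') := by
  refine connOn_of_forall_exists_adj h fun P a ha haP b hb hbP => ?_
  by_contra hcon
  have hM : ∀ u ∈ compOn T (S ∩ S') a, u ∈ P := by
    intro u hu
    by_contra huP
    obtain ⟨c, hc, hc', d, hd, hd', hcd⟩ := (connOn_compOn ha).exists_adj (mem_compOn_self ha) haP
      hu huP
    exact hcon ⟨c, compOn_subset hc, hc', d, compOn_subset hd, hd', hcd⟩
  set M := compOn T (S ∩ S') a
  have hbU : b ∈ S \ M := ⟨hb.1, fun h => hbP (hM b h)⟩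
  obtain ⟨q, hq, p, hp, hpU, hqp⟩ := hS.exists_adj_compOn (U := S \ M) Set.sdiff_subset hbU ha.1
    fun h => h.2 (mem_compOn_self ha)
  have hpM : p ∈ M := by
    by_contra h; exact hpU ⟨hp, h⟩
  have hqS := compOn_subset hq
  have hqS' : q ∉ S' := fun h => hqS.2 (mem_compOn_of_adj hpM ⟨hqS.1, h⟩ hqp.symm)
  exact Set.disjoint_left.1 (disjoint_of_adj hT hqp (connOn_compOn hbU) hS' hq
    (fun h => (compOn_subset h).2 hpM) (compOn_subset hpM).2 hqS') (mem_compOn_self hbU) hb.2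

/-- Without a common node, let `qp` be the edge by which the part of `A \ B` containing a node of
`C` is attached to `B`. That part together with `C` avoids `p`, so it is disjoint from `B`, although
`C` meets `B`. -/
lemma helly_three (hT : T.IsAcyclic) {A B C : Set ι} (hA : ConnOn T A) (hB : ConnOn T B)
    (hC : ConnOn T C) (hAB : (A ∩ B).Nonempty) (hBC : (B ∩ C).Nonempty) (hAC : (A ∩ C).Nonempty) :
    (A ∩ B ∩ C).Nonempty := by
  by_contra hcon
  rw [Set.not_nonempty_iff_eq_empty, Set.eq_empty_iff_forall_notMem] at hcon
  obtain ⟨s, hsA, hsB⟩ := hAB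
  obtain ⟨t, htA, htC⟩ := hAC
  obtain ⟨r, hrB, hrC⟩ := hBC
  have htU : t ∈ A \ B := ⟨htA, fun h => hcon t ⟨⟨htA, h⟩, htC⟩⟩
  obtain ⟨q, hq, p, hp, hpU, hqp⟩ := hA.exists_adj_compOn (U := A \ B) Set.sdiff_subset htU hsA
    fun h => h.2 hsB
  have hpB : p ∈ B := by
    by_contra h; exact hpU ⟨hp, h⟩
  have hM := (connOn_compOn htU).union hC ⟨t, mem_compOn_self htU, htC⟩
  refine Set.disjoint_left.1 (disjoint_of_adj hT hqp hM hB (.inl hq) ?_ hpB (compOn_subset hq).2)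
    (.inr hrC) hrB
  rintro (h | h)
  · exact (compOn_subset h).2 hpB
  · exact hcon p ⟨⟨hp, hpB⟩, h⟩

/-- Helly property of four subtrees. -/
lemma helly_four (hT : T.IsAcyclic) {A B C E : Set ι} (hA : ConnOn T A) (hB : ConnOn T B)
    (hC : ConnOn T C) (hE : ConnOn T E) (hAB : (A ∩ B).Nonempty) (hBC : (B ∩ C).Nonempty)
    (hAC : (A ∩ C).Nonempty) (hAE : (A ∩ E).Nonempty) (hBE : (B ∩ E).Nonempty)
    (hCE : (C ∩ E).Nonempty) : (A ∩ B ∩ C ∩ E).Nonempty :=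
  helly_three hT (hA.inter hT hB hAB) hC hE (helly_three hT hA hB hC hAB hBC hAC) hCE
    (helly_three hT hA hB hE hAB hBE hAE)

end Acyclic

/-! ### Directed paths in an oriented tree -/

section DirectedPath

variable {ι : Type*} {D : Digraph ι}

/-- Indexing by natural numbers instead of `Fin` leaves only linear arithmetic on indices. -/
lemma inducesDirectedPath_iff {S : Set ι} : InducesDirectedPath D S ↔
    ∃ (m : ℕ) (f : ℕ → ι), Set.InjOn f (Set.Iic m) ∧ f '' Set.Iic m = S ∧
      ∀ i ≤ m, ∀ j ≤ m, (D.Adj (f i) (f j) ↔ i + 1 = j) := by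
  constructor
  · rintro ⟨m, p, hp, rfl, h⟩
    have hmin : ∀ i, min i m < m + 1 := fun i => by omega
    refine ⟨m, fun i => p ⟨min i m, hmin i⟩, ?_, ?_, ?_⟩
    · intro i hi j hj hij
      have := Fin.mk.inj_iff.1 (hp hij)
      rw [Set.mem_Iic] at hi hj
      omega
    · ext x
      constructor
      · rintro ⟨i, -, rfl⟩; exact ⟨_, rfl⟩
      · rintro ⟨i, rfl⟩
        refine ⟨i, Set.mem_Iic.2 (by omega), ?_⟩
        exact congrArg p (Fin.ext (min_eq_left (by omega)))
    · intro i hi j hj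
      rw [h]
      simp only
      omega
  · rintro ⟨m, f, hf, rfl, h⟩
    refine ⟨m, fun i => f i, ?_, ?_, ?_⟩
    · intro i j hij
      exact Fin.ext (hf (Set.mem_Iic.2 (by omega)) (Set.mem_Iic.2 (by omega)) hij)
    · ext x
      constructor
      · rintro ⟨i, rfl⟩; exact ⟨i, Set.mem_Iic.2 (by omega), rfl⟩
      · rintro ⟨i, hi, rfl⟩; exact ⟨⟨i, Nat.lt_succ_of_le hi⟩, rfl⟩
    · intro i j
      exact h i (by omega) j (by omega)

lemma toSimpleGraphInclusive_adj {x y : ι} :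
    D.toSimpleGraphInclusive.Adj x y ↔ x ≠ y ∧ (D.Adj x y ∨ D.Adj y x) :=
  SimpleGraph.fromRel_adj _ _ _

lemma connOn_image_Icc {T : SimpleGraph ι} (f : ℕ → ι) {i j : ℕ} (hij : i ≤ j)
    (h : ∀ k, i ≤ k → k < j → T.Adj (f k) (f (k + 1))) : ConnOn T (f '' Set.Icc i j) := by
  induction j, hij using Nat.le_induction with
  | base => simpa using connOn_singleton (f i)
  | succ j hij ih =>
    have h1 := (ih fun k hk hk' => h k hk (by omega)).insert (v := f (j + 1)) (u := f j)
      ⟨j, ⟨hij, le_rfl⟩, rfl⟩ (h j hij (by omega)).symm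
    rw [← Set.image_insert_eq] at h1
    convert h1 using 2
    ext k
    simp only [Set.mem_Icc, Set.mem_insert_iff]
    omega

lemma adj_of_directedPath {m : ℕ} {f : ℕ → ι} (hf : Set.InjOn f (Set.Iic m))
    (h : ∀ i ≤ m, ∀ j ≤ m, (D.Adj (f i) (f j) ↔ i + 1 = j)) {k : ℕ} (hk : k < m) :
    D.toSimpleGraphInclusive.Adj (f k) (f (k + 1)) := by
  rw [toSimpleGraphInclusive_adj]
  refine ⟨fun he => ?_, .inl ((h k hk.le (k + 1) hk).2 rfl)⟩
  have := hf (Set.mem_Iic.2 hk.le) (Set.mem_Iic.2 hk) he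
  omega

lemma InducesDirectedPath.connOn {S : Set ι} (h : InducesDirectedPath D S) :
    ConnOn D.toSimpleGraphInclusive S := by
  obtain ⟨m, f, hf, rfl, hD⟩ := inducesDirectedPath_iff.1 h
  have := connOn_image_Icc f (Nat.zero_le m) fun k _ hk => adj_of_directedPath hf hD hk
  rwa [show Set.Icc 0 m = Set.Iic m from by ext; simp] at this

lemma mem_of_directedPath (hT : D.toSimpleGraphInclusive.IsAcyclic) {m : ℕ} {f : ℕ → ι}
    (hf : Set.InjOn f (Set.Iic m)) (h : ∀ i ≤ m, ∀ j ≤ m, (D.Adj (f i) (f j) ↔ i + 1 = j))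
    {K : Set ι} (hK : ConnOn D.toSimpleGraphInclusive K) {i j k : ℕ} (hij : i ≤ j) (hjk : j ≤ k)
    (hk : k ≤ m) (hiK : f i ∈ K) (hkK : f k ∈ K) : f j ∈ K := by
  by_contra hj
  have hij' : i < j := lt_of_le_of_ne hij (by rintro rfl; exact hj hiK)
  have hjk' : j < k := lt_of_le_of_ne hjk (by rintro rfl; exact hj hkK)
  have h1 := connOn_image_Icc f hij fun l _ hl => adj_of_directedPath hf h (lt_of_lt_of_le hl (hjk.trans hk))
  have h2 := (connOn_image_Icc (i := j + 1) f (by omega) fun l _ hl =>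
    adj_of_directedPath hf h (lt_of_lt_of_le hl hk)).union hK ⟨f k, ⟨k, by simp; omega, rfl⟩, hkK⟩
  have hinj : ∀ a b, a ≤ m → b ≤ m → f a = f b → a = b := fun a b ha hb hab => hf ha hb hab
  refine Set.disjoint_left.1 (disjoint_of_adj hT (adj_of_directedPath hf h (by omega : j < m)) h1 h2
    ⟨j, by simp; omega, rfl⟩ ?_ (.inl ⟨j + 1, by simp; omega, rfl⟩) ?_) ⟨i, by simp; omega, rfl⟩
    (.inr hiK)
  · rintro ⟨l, hl, hl'⟩
    rw [Set.mem_Icc] at hl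
    have := hinj l (j + 1) (by omega) (by omega) hl'
    omega
  · rintro (⟨l, hl, hl'⟩ | h)
    · rw [Set.mem_Icc] at hl
      have := hinj l j (by omega) (by omega) hl'
      omega
    · exact hj h

/-- By `mem_of_directedPath` a connected part of a directed path is a segment of it, so only one arc
of the path enters it. `eq_of_adj_out` is the mirror image. Only the argument for `S3` needs the
orientation in this way. -/
lemma eq_of_adj_into (hT : D.toSimpleGraphInclusive.IsAcyclic) {S K : Set ι}
    (hS : InducesDirectedPath D S) (hK : ConnOn D.toSimpleGraphInclusive K) (hKS : K ⊆ S)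
    {p q p' q' : ι} (hp : p ∈ K) (hp' : p' ∈ K) (hq : q ∈ S) (hq' : q' ∈ S) (hqK : q ∉ K)
    (hqK' : q' ∉ K) (h : D.Adj q p) (h' : D.Adj q' p') : q = q' := by
  obtain ⟨m, f, hf, rfl, hD⟩ := inducesDirectedPath_iff.1 hS
  obtain ⟨i, hi, rfl⟩ := hq
  obtain ⟨i', hi', rfl⟩ := hq'
  obtain ⟨j, hj, rfl⟩ := hKS hp
  obtain ⟨j', hj', rfl⟩ := hKS hp'
  have h1 := (hD i hi j hj).1 h
  have h2 := (hD i' hi' j' hj').1 h'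
  subst h1 h2
  rw [Set.mem_Iic] at *
  rcases lt_trichotomy i i' with hlt | rfl | hlt
  · exact absurd (mem_of_directedPath hT hf hD hK (by omega : i + 1 ≤ i') (Nat.le_succ i') hj' hp hp')
      hqK'
  · rfl
  · exact absurd (mem_of_directedPath hT hf hD hK (by omega : i' + 1 ≤ i) (Nat.le_succ i) hj hp' hp)
      hqK

lemma eq_of_adj_out (hT : D.toSimpleGraphInclusive.IsAcyclic) {S K : Set ι}
    (hS : InducesDirectedPath D S) (hK : ConnOn D.toSimpleGraphInclusive K) (hKS : K ⊆ S)
    {p q p' q' : ι} (hp : p ∈ K) (hp' : p' ∈ K) (hq : q ∈ S) (hq' : q' ∈ S) (hqK : q ∉ K)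
    (hqK' : q' ∉ K) (h : D.Adj p q) (h' : D.Adj p' q') : q = q' := by
  obtain ⟨m, f, hf, rfl, hD⟩ := inducesDirectedPath_iff.1 hS
  obtain ⟨i, hi, rfl⟩ := hq
  obtain ⟨i', hi', rfl⟩ := hq'
  obtain ⟨j, hj, rfl⟩ := hKS hp
  obtain ⟨j', hj', rfl⟩ := hKS hp'
  have h1 := (hD j hj i hi).1 h
  have h2 := (hD j' hj' i' hi').1 h'
  subst h1 h2
  rw [Set.mem_Iic] at *
  rcases lt_trichotomy j j' with hlt | rfl | hlt
  · exact absurd (mem_of_directedPath hT hf hD hK (Nat.le_succ j) (by omega : j + 1 ≤ j') hj' hp hp')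
      hqK
  · rfl
  · exact absurd (mem_of_directedPath hT hf hD hK (Nat.le_succ j') (by omega : j' + 1 ≤ j) hj hp' hp)
      hqK'

lemma not_three_neighbors {S : Set ι} (hS : InducesDirectedPath D S) {x : ι} (hx : x ∈ S)
    (n : Fin 3 → ι) (hn : Function.Injective n) (hnS : ∀ i, n i ∈ S)
    (h : ∀ i, D.toSimpleGraphInclusive.Adj x (n i)) : False := by
  obtain ⟨m, f, hf, rfl, hD⟩ := inducesDirectedPath_iff.1 hS
  obtain ⟨j, hj, rfl⟩ := hx
  choose k hk hkn using hnS
  have hk' : ∀ i, k i = j + 1 ∨ k i + 1 = j := by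
    intro i
    have h1 := (toSimpleGraphInclusive_adj.1 (h i)).2
    rw [← hkn i] at h1
    rcases h1 with h1 | h1
    · exact .inl ((hD _ hj _ (hk i)).1 h1).symm
    · exact .inr ((hD _ (hk i) _ hj).1 h1)
  have hkne : ∀ i i', i ≠ i' → k i ≠ k i' := fun i i' hii h => hii (hn (by rw [← hkn, ← hkn, h]))
  have := hkne 0 1 (by decide)
  have := hkne 0 2 (by decide)
  have := hkne 1 2 (by decide)
  have := hk' 0
  have := hk' 1
  have := hk' 2
  omega

end DirectedPath

/-! ### Excluding `K4` and `S3` -/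

section Obstructions

variable {V ι : Type*} {G : SimpleGraph V} {D : Digraph ι} {bag : ι → Set V}

/-- The bags form a directed spaghetti tree decomposition of width at most two of the subgraph
of `G` induced by `A`. -/
structure IsSpaghetti (G : SimpleGraph V) (A : Set V) (D : Digraph ι) (bag : ι → Set V) : Prop where
  isTree : D.toSimpleGraphInclusive.IsTree
  asymm : ∀ x y, D.Adj x y → ¬ D.Adj y x
  bag_subset : ∀ x, bag x ⊆ A
  encard_le : ∀ x, (bag x).encard ≤ 3
  exists_adj_mem_bag : ∀ u ∈ A, ∀ v ∈ A, G.Adj u v → ∃ x, u ∈ bag x ∧ v ∈ bag x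
  inducesDirectedPath : ∀ v ∈ A, InducesDirectedPath D {x | v ∈ bag x}

/-- The nodes whose bags meet `M`. -/
def nodesOf (bag : ι → Set V) (M : Set V) : Set ι := ⋃ v ∈ M, {x | v ∈ bag x}

lemma mem_nodesOf {M : Set V} {x : ι} : x ∈ nodesOf bag M ↔ ∃ v ∈ M, v ∈ bag x := by
  simp [nodesOf]

lemma eq_of_encard_le_three {S : Set V} (h : S.encard ≤ 3) {a b c d : V} (ha : a ∈ S) (hb : b ∈ S)
    (hc : c ∈ S) (hd : d ∈ S) (hab : a ≠ b) (hac : a ≠ c) (had : a ≠ d) (hbc : b ≠ c)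
    (hbd : b ≠ d) : c = d := by
  by_contra hcd
  have h1 : ({a, b, c, d} : Set V).encard ≤ S.encard := Set.encard_le_encard (by
    rintro x (rfl | rfl | rfl | rfl) <;> assumption)
  rw [Set.encard_insert_of_notMem (by simp [*]), Set.encard_insert_of_notMem (by simp [*]),
    Set.encard_pair hcd] at h1
  have := h1.trans h
  norm_num at this

namespace IsSpaghetti

variable (hI : IsSpaghetti G Set.univ D bag)

include hI

lemma connOn_nodes (v : V) : ConnOn D.toSimpleGraphInclusive {x | v ∈ bag x} :=
  (hI.inducesDirectedPath v trivial).connOn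

lemma connOn_nodesOf {M : Set V} (hM : ConnOn G M) :
    ConnOn D.toSimpleGraphInclusive (nodesOf bag M) :=
  connOn_biUnion hM _ (fun v _ => hI.connOn_nodes v) fun u _ v _ huv =>
    hI.exists_adj_mem_bag u trivial v trivial huv

lemma nodesOf_inter_nonempty {M N : Set V} {u v : V} (hu : u ∈ M) (hv : v ∈ N) (h : G.Adj u v) :
    (nodesOf bag M ∩ nodesOf bag N).Nonempty := by
  obtain ⟨x, hx, hx'⟩ := hI.exists_adj_mem_bag u trivial v trivial h
  exact ⟨x, mem_nodesOf.2 ⟨u, hu, hx⟩, mem_nodesOf.2 ⟨v, hv, hx'⟩⟩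

/-- Otherwise, take the component, among the vertices of `M` missing from `bag p`, of one that lies
in `bag q`. It has an edge to some `b ∈ M` in `bag p`, yet its nodes and those of `b` lie on
different sides of the bridge `pq`. -/
lemma exists_mem_of_adj {M : Set V} (hM : ConnOn G M) {p q : ι} (hp : p ∈ nodesOf bag M)
    (hq : q ∈ nodesOf bag M) (h : D.toSimpleGraphInclusive.Adj p q) :
    ∃ v ∈ M, v ∈ bag p ∧ v ∈ bag q := by
  by_contra! hcon
  obtain ⟨u, hu, hup⟩ := mem_nodesOf.1 hp
  obtain ⟨u', hu', hu'q⟩ := mem_nodesOf.1 hq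
  have hu'U : u' ∈ {v ∈ M | p ∉ {x | v ∈ bag x}} := ⟨hu', fun h => hcon u' hu' h hu'q⟩
  obtain ⟨a, ha, b, hb, hb', hab⟩ := hM.exists_adj_compOn (U := {v ∈ M | p ∉ {x | v ∈ bag x}})
    (Set.sep_subset _ _) hu'U hu fun h => h.2 hup
  have hpb : p ∈ {x | b ∈ bag x} := by
    by_contra h; exact hb' ⟨hb, h⟩
  obtain ⟨x, hx, hx'⟩ := hI.exists_adj_mem_bag a trivial b trivial hab
  refine Set.disjoint_left.1 (disjoint_of_adj hI.isTree.isAcyclic h.symm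
    (hI.connOn_nodesOf (connOn_compOn hu'U)) (hI.connOn_nodes b) ?_ ?_ hpb (hcon b hb hpb))
    (mem_nodesOf.2 ⟨a, ha, hx⟩) hx'
  · exact mem_nodesOf.2 ⟨u', mem_compOn_self hu'U, hu'q⟩
  · intro h
    obtain ⟨v, hv, hv'⟩ := mem_nodesOf.1 h
    exact (compOn_subset hv).2 hv'

/-- If the bags of a subtree meet a connected set `M` in one vertex each, then this is the same
vertex for all of them, and it is in every neighbouring bag that meets `M`. -/
lemma exists_common {M : Set V} (hM : ConnOn G M) {K : Set ι}
    (hK : ConnOn D.toSimpleGraphInclusive K) (hKM : K ⊆ nodesOf bag M)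
    (h1 : ∀ x ∈ K, ∀ u ∈ M, ∀ v ∈ M, u ∈ bag x → v ∈ bag x → u = v) :
    ∃ a ∈ M, K ⊆ {x | a ∈ bag x} ∧ ∀ p ∈ K, ∀ q ∈ nodesOf bag M,
      D.toSimpleGraphInclusive.Adj p q → a ∈ bag q := by
  obtain ⟨x, hx⟩ := hK.nonempty
  obtain ⟨a, haM, hax⟩ := mem_nodesOf.1 (hKM hx)
  have hKa : K ⊆ {x | a ∈ bag x} := by
    intro y hy
    by_contra hya
    obtain ⟨p, hp, hp', q, hq, hq', hpq⟩ := hK.exists_adj (P := {x | a ∈ bag x}) hx hax hy hya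
    obtain ⟨v, hv, hvp, hvq⟩ := hI.exists_mem_of_adj hM (hKM hp) (hKM hq) hpq
    exact hq' (h1 p hp a haM v hv hp' hvp ▸ hvq)
  refine ⟨a, haM, hKa, fun p hp q hq hpq => ?_⟩
  obtain ⟨v, hv, hvp, hvq⟩ := hI.exists_mem_of_adj hM (hKM hp) hq hpq
  exact h1 p hp a haM v hv (hKa hp) hvp ▸ hvq

lemma not_mem_nodesOf {A B C E : Set V} (hAB : Disjoint A B) (hAC : Disjoint A C)
    (hAE : Disjoint A E) (hBC : Disjoint B C) (hBE : Disjoint B E) (hCE : Disjoint C E) {x : ι}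
    (hA : x ∈ nodesOf bag A) (hB : x ∈ nodesOf bag B) (hC : x ∈ nodesOf bag C) :
    x ∉ nodesOf bag E := by
  intro hE
  obtain ⟨a, ha, ha'⟩ := mem_nodesOf.1 hA
  obtain ⟨b, hb, hb'⟩ := mem_nodesOf.1 hB
  obtain ⟨c, hc, hc'⟩ := mem_nodesOf.1 hC
  obtain ⟨e, he, he'⟩ := mem_nodesOf.1 hE
  exact hCE.ne_of_mem hc he (eq_of_encard_le_three (hI.encard_le x) ha' hb' hc' he'
    (hAB.ne_of_mem ha hb) (hAC.ne_of_mem ha hc) (hAE.ne_of_mem ha he) (hBC.ne_of_mem hb hc)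
    (hBE.ne_of_mem hb he))

lemma eq_of_mem_bag {A B C : Set V} (hAB : Disjoint A B) (hAC : Disjoint A C) (hBC : Disjoint B C)
    {x : ι} (hB : x ∈ nodesOf bag B) (hC : x ∈ nodesOf bag C) {u v : V} (hu : u ∈ A) (hv : v ∈ A)
    (hux : u ∈ bag x) (hvx : v ∈ bag x) : u = v := by
  obtain ⟨b, hb, hb'⟩ := mem_nodesOf.1 hB
  obtain ⟨c, hc, hc'⟩ := mem_nodesOf.1 hC
  exact eq_of_encard_le_three (hI.encard_le x) hb' hc' hux hvx (hBC.ne_of_mem hb hc)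
    (hAB.symm.ne_of_mem hb hu) (hAB.symm.ne_of_mem hb hv) (hAC.symm.ne_of_mem hc hu)
    (hAC.symm.ne_of_mem hc hv)

lemma not_hasMinor_K4 : ¬ HasMinor G K4 := by
  rintro ⟨B, hB, hd, ha⟩
  have hS : ∀ i, ConnOn D.toSimpleGraphInclusive (nodesOf bag (B i)) := fun i =>
    hI.connOn_nodesOf (hB i)
  have hn : ∀ i j, i ≠ j → (nodesOf bag (B i) ∩ nodesOf bag (B j)).Nonempty := by
    intro i j hij
    obtain ⟨u, hu, v, hv, huv⟩ := ha i j (by simpa [K4] using hij)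
    exact hI.nodesOf_inter_nonempty hu hv huv
  obtain ⟨x, ⟨⟨h0, h1⟩, h2⟩, h3⟩ := helly_four hI.isTree.isAcyclic (hS 0) (hS 1) (hS 2) (hS 3)
    (hn _ _ (by decide)) (hn _ _ (by decide)) (hn _ _ (by decide)) (hn _ _ (by decide))
    (hn _ _ (by decide)) (hn _ _ (by decide))
  exact hI.not_mem_nodesOf (hd 0 1 (by decide)) (hd 0 2 (by decide)) (hd 0 3 (by decide))
    (hd 1 2 (by decide)) (hd 1 3 (by decide)) (hd 2 3 (by decide)) h0 h1 h2 h3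

/-- By the Helly property the subtree common to `A` and `B` meets the nodes of `E` as well as those
of `C`. No bag meets all four sets, so somewhere this subtree leaves the nodes of `C`. -/
lemma exists_exit {A B C E : Set V} (hA : ConnOn G A) (hB : ConnOn G B)
    (hE : ConnOn G E) (hAB : Disjoint A B) (hAC : Disjoint A C) (hAE : Disjoint A E)
    (hBC : Disjoint B C) (hBE : Disjoint B E) (hCE : Disjoint C E)
    (nAE : (nodesOf bag A ∩ nodesOf bag E).Nonempty)
    (nBE : (nodesOf bag B ∩ nodesOf bag E).Nonempty)
    (nABC : (nodesOf bag A ∩ nodesOf bag B ∩ nodesOf bag C).Nonempty) :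
    ∃ p ∈ nodesOf bag A ∩ nodesOf bag B ∩ nodesOf bag C,
      ∃ q ∈ nodesOf bag A ∩ nodesOf bag B, q ∉ nodesOf bag C ∧
      D.toSimpleGraphInclusive.Adj p q := by
  have hT := hI.isTree.isAcyclic
  obtain ⟨x, hx, hxC⟩ := nABC
  obtain ⟨y, hy, hyE⟩ := helly_three hT (hI.connOn_nodesOf hA) (hI.connOn_nodesOf hB)
    (hI.connOn_nodesOf hE) ⟨x, hx⟩ nBE nAE
  have hyC : y ∉ nodesOf bag C := hI.not_mem_nodesOf hAB hAE hAC hBE hBC hCE.symm hy.1 hy.2 hyE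
  obtain ⟨p, hp, hpC, q, hq, hqC, hpq⟩ := ((hI.connOn_nodesOf hA).inter hT (hI.connOn_nodesOf hB)
    ⟨x, hx⟩).exists_adj hx hxC hy hyC
  exact ⟨p, ⟨hp, hpC⟩, q, hq, hqC, hpq⟩

/-- Every bag of `I` consists of one vertex from each of the sets 1, 3 and 5, and these are the same
vertices `a`, `b`, `c` throughout `I`. The sets 2, 4 and 0 force three exits from `I`, whose outer
bags contain `a, b`, then `b, c`, then `a, c`. -/
lemma not_hasMinor_S3 : ¬ HasMinor G S3 := by
  rintro ⟨B, hB, hd, ha⟩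
  have hT := hI.isTree.isAcyclic
  have hn : ∀ i j, S3.Adj i j → (nodesOf bag (B i) ∩ nodesOf bag (B j)).Nonempty := by
    intro i j hij
    obtain ⟨u, hu, v, hv, huv⟩ := ha i j hij
    exact hI.nodesOf_inter_nonempty hu hv huv
  have hS : ∀ i, ConnOn D.toSimpleGraphInclusive (nodesOf bag (B i)) := fun i =>
    hI.connOn_nodesOf (hB i)
  set I := nodesOf bag (B 1) ∩ nodesOf bag (B 3) ∩ nodesOf bag (B 5) with hIdef
  have n13 := hn 1 3 (by simp [S3])
  have n35 := hn 3 5 (by simp [S3])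
  have n15 := hn 1 5 (by simp [S3])
  have hI0 : I.Nonempty := helly_three hT (hS 1) (hS 3) (hS 5) n13 n35 n15
  have hIc : ConnOn D.toSimpleGraphInclusive I :=
    ((hS 1).inter hT (hS 3) n13).inter hT (hS 5) hI0
  have e1 : I = nodesOf bag (B 3) ∩ nodesOf bag (B 5) ∩ nodesOf bag (B 1) := by
    ext x; simp only [hIdef, Set.mem_inter_iff]; tauto
  have e2 : I = nodesOf bag (B 1) ∩ nodesOf bag (B 5) ∩ nodesOf bag (B 3) := by
    ext x; simp only [hIdef, Set.mem_inter_iff]; tauto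
  have d13 := hd 1 3 (by decide)
  have d15 := hd 1 5 (by decide)
  have d35 := hd 3 5 (by decide)
  obtain ⟨a, -, haI, ha'⟩ := hI.exists_common (hB 1) hIc (fun x hx => hx.1.1)
    fun x hx u hu v hv => hI.eq_of_mem_bag d13 d15 d35 hx.1.2 hx.2 hu hv
  obtain ⟨b, -, hbI, hb'⟩ := hI.exists_common (hB 3) hIc (fun x hx => hx.1.2)
    fun x hx u hu v hv => hI.eq_of_mem_bag d13.symm d35 d15 hx.1.1 hx.2 hu hv
  obtain ⟨c, -, hcI, hc'⟩ := hI.exists_common (hB 5) hIc (fun x hx => hx.2)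
    fun x hx u hu v hv => hI.eq_of_mem_bag d15.symm d35.symm d13 hx.1.1 hx.1.2 hu hv
  obtain ⟨p, hp, q, hq, hqn, hpq⟩ := hI.exists_exit (hB 1) (hB 3) (hB 2) d13 d15
    (hd 1 2 (by decide)) d35 (hd 3 2 (by decide)) (hd 5 2 (by decide)) (hn 1 2 (by simp [S3]))
    (hn 3 2 (by simp [S3])) hI0
  obtain ⟨p', hp', q', hq', hqn', hpq'⟩ := hI.exists_exit (hB 3) (hB 5) (hB 4) d35 d13.symm
    (hd 3 4 (by decide)) d15.symm (hd 5 4 (by decide)) (hd 1 4 (by decide)) (hn 3 4 (by simp [S3]))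
    (hn 5 4 (by simp [S3])) (e1 ▸ hI0)
  obtain ⟨r, hr, s, hs, hsn, hrs⟩ := hI.exists_exit (hB 1) (hB 5) (hB 0) d15 d13
    (hd 1 0 (by decide)) d35.symm (hd 5 0 (by decide)) (hd 3 0 (by decide)) (hn 1 0 (by simp [S3]))
    (hn 5 0 (by simp [S3])) (e2 ▸ hI0)
  rw [← e1] at hp'
  rw [← e2] at hr
  rw [← hIdef] at hp
  have hqI : q ∉ I := fun h => hqn h.2
  have hqI' : q' ∉ I := fun h => hqn' h.1.1
  have hsI : s ∉ I := fun h => hsn h.1.2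
  have h1 : q ≠ q' := by rintro rfl; exact hqn hq'.2
  have h2 : q ≠ s := by rintro rfl; exact hqn hs.2
  have h3 : q' ≠ s := by rintro rfl; exact hqn' hs.1
  have pa := hI.inducesDirectedPath a trivial
  have pb := hI.inducesDirectedPath b trivial
  have pc := hI.inducesDirectedPath c trivial
  -- Two of the three exits have the same orientation relative to `I`. They share one of `a`, `b`,
  -- `c`, whose directed path would then leave or enter `I` twice.
  rcases (toSimpleGraphInclusive_adj.1 hpq).2 with o1 | o1 <;>
    rcases (toSimpleGraphInclusive_adj.1 hpq').2 with o2 | o2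
  · exact h1 (eq_of_adj_out hT pb hIc hbI hp hp' (hb' p hp q hq.2 hpq) (hb' p' hp' q' hq'.1 hpq')
      hqI hqI' o1 o2)
  · rcases (toSimpleGraphInclusive_adj.1 hrs).2 with o3 | o3
    · exact h2 (eq_of_adj_out hT pa hIc haI hp hr (ha' p hp q hq.1 hpq) (ha' r hr s hs.1 hrs)
        hqI hsI o1 o3)
    · exact h3 (eq_of_adj_into hT pc hIc hcI hp' hr (hc' p' hp' q' hq'.2 hpq') (hc' r hr s hs.2 hrs)
        hqI' hsI o2 o3)
  · rcases (toSimpleGraphInclusive_adj.1 hrs).2 with o3 | o3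
    · exact h3 (eq_of_adj_out hT pc hIc hcI hp' hr (hc' p' hp' q' hq'.2 hpq') (hc' r hr s hs.2 hrs)
        hqI' hsI o2 o3)
    · exact h2 (eq_of_adj_into hT pa hIc haI hp hr (ha' p hp q hq.1 hpq) (ha' r hr s hs.1 hrs)
        hqI hsI o1 o3)
  · exact h1 (eq_of_adj_into hT pb hIc hbI hp hp' (hb' p hp q hq.2 hpq) (hb' p' hp' q' hq'.1 hpq')
      hqI hqI' o1 o2)

end IsSpaghetti

end Obstructions

/-! ### Excluding `D3` -/

section Theta

variable {V ι : Type*} {G : SimpleGraph V} {D : Digraph ι} {bag : ι → Set V}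

namespace IsSpaghetti

variable (hI : IsSpaghetti G Set.univ D bag)

include hI

/-- Some bag meets `M`, `N` and the leg. If it meets `A`, the subtree common to `N` and `A` must
also reach `B`, where there is no room for `M`; so it drops `M` while keeping `N`. If it meets `B`,
the roles are exchanged. Legs with two inner sets are needed for this. -/
lemma exists_exit_of_path {M N A B : Set V} (hM : ConnOn G M) (hN : ConnOn G N) (hA : ConnOn G A)
    (hB : ConnOn G B) (hMN : Disjoint M N) (hMA : Disjoint M A) (hMB : Disjoint M B)
    (hNA : Disjoint N A) (hNB : Disjoint N B) (hAB : Disjoint A B)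
    (nMN : (nodesOf bag M ∩ nodesOf bag N).Nonempty)
    (nMA : (nodesOf bag M ∩ nodesOf bag A).Nonempty)
    (nAB : (nodesOf bag A ∩ nodesOf bag B).Nonempty)
    (nBN : (nodesOf bag B ∩ nodesOf bag N).Nonempty) :
    ∃ z ∈ nodesOf bag M ∩ nodesOf bag N, z ∈ nodesOf bag (A ∪ B) ∧
      ∃ z', D.toSimpleGraphInclusive.Adj z z' ∧
        (z' ∈ nodesOf bag M ∧ z' ∉ nodesOf bag N ∨ z' ∈ nodesOf bag N ∧ z' ∉ nodesOf bag M) := by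
  have hT := hI.isTree.isAcyclic
  have e : nodesOf bag (A ∪ B) = nodesOf bag A ∪ nodesOf bag B := Set.biUnion_union _ _ _
  have hc : ConnOn D.toSimpleGraphInclusive (nodesOf bag (A ∪ B)) :=
    e ▸ (hI.connOn_nodesOf hA).union (hI.connOn_nodesOf hB) nAB
  obtain ⟨u, ⟨huM, huN⟩, hu⟩ := helly_three hT (hI.connOn_nodesOf hM) (hI.connOn_nodesOf hN) hc nMN
    (e ▸ nBN.mono fun x hx => ⟨hx.2, .inr hx.1⟩) (e ▸ nMA.mono fun x hx => ⟨hx.1, .inl hx.2⟩)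
  rw [e] at hu ⊢
  rcases hu with hu | hu
  · obtain ⟨z, hz, z', hz', hz'n, hzz'⟩ := hI.exists_exit hN hA hB hNA hMN.symm hNB hMA.symm hAB hMB
      (nBN.mono fun x hx => ⟨hx.2, hx.1⟩) nAB ⟨u, ⟨huN, hu⟩, huM⟩
    exact ⟨z, ⟨hz.2, hz.1.1⟩, .inl hz.1.2, z', hzz', .inr ⟨hz'.1, hz'n⟩⟩
  · obtain ⟨z, hz, z', hz', hz'n, hzz'⟩ := hI.exists_exit hM hB hA hMB hMN hMA hNB.symm hAB.symm hNA
      nMA (nAB.mono fun x hx => ⟨hx.2, hx.1⟩) ⟨u, ⟨huM, hu⟩, huN⟩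
    exact ⟨z, ⟨hz.1.1, hz.2⟩, .inr hz.1.2, z', hzz', .inl ⟨hz'.1, hz'n⟩⟩

/-- If the two subtrees were disjoint, each leg would have to pass the node `p` of `M` at which the
part of the tree containing `N` is attached. The bag of `p` would then meet `M` and all three legs.
-/
lemma nodesOf_inter_nonempty_of_theta {M N : Set V} {P : Fin 3 → Set V} (hM : ConnOn G M)
    (hN : ConnOn G N) (hP : ∀ i, ConnOn G (P i)) (hMP : ∀ i, Disjoint M (P i))
    (hPP : ∀ i j, i ≠ j → Disjoint (P i) (P j))
    (nMP : ∀ i, (nodesOf bag M ∩ nodesOf bag (P i)).Nonempty)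
    (nNP : ∀ i, (nodesOf bag N ∩ nodesOf bag (P i)).Nonempty) :
    (nodesOf bag M ∩ nodesOf bag N).Nonempty := by
  by_contra hcon
  rw [Set.not_nonempty_iff_eq_empty, Set.eq_empty_iff_forall_notMem] at hcon
  have hT := hI.isTree.isAcyclic
  have hMc := hI.connOn_nodesOf hM
  have hNc := hI.connOn_nodesOf hN
  obtain ⟨y, hy⟩ := hNc.nonempty
  obtain ⟨x, hx⟩ := hMc.nonempty
  have hyU : y ∈ (nodesOf bag M)ᶜ := fun h => hcon y ⟨h, hy⟩
  obtain ⟨q, hq, p, -, hp, hqp⟩ := (connOn_univ.2 hI.isTree.connected).exists_adj_compOn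
    (Set.subset_univ _) hyU (Set.mem_univ x) fun h => h hx
  rw [Set.notMem_compl_iff] at hp
  have hNs : nodesOf bag N ⊆ compOn D.toSimpleGraphInclusive (nodesOf bag M)ᶜ y :=
    hNc.subset_compOn (fun z hz h => hcon z ⟨h, hz⟩) hy (mem_compOn_self hyU)
  have hL := (connOn_compOn hyU).insert hq hqp.symm
  have hpP : ∀ i, p ∈ nodesOf bag (P i) := by
    intro i
    obtain ⟨z, ⟨hz1, hz2⟩, hz3⟩ := helly_three hT hMc hL (hI.connOn_nodesOf (hP i))
      ⟨p, hp, .inl rfl⟩ ((nNP i).mono fun z hz => ⟨.inr (hNs hz.1), hz.2⟩) (nMP i)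
    rcases hz2 with rfl | hz2
    · exact hz3
    · exact absurd hz1 (compOn_subset hz2)
  exact hI.not_mem_nodesOf (hMP 0) (hMP 1) (hMP 2) (hPP 0 1 (by decide)) (hPP 0 2 (by decide))
    (hPP 1 2 (by decide)) hp (hpP 0) (hpP 1) (hpP 2)

omit hI in
/-- Any three nodes of a subtree have a median in it, with neighbours in distinct directions. -/
lemma exists_median [Finite ι] {T : SimpleGraph ι} (hT : T.IsAcyclic) {I : Set ι} (hI : ConnOn T I)
    (z : Fin 3 → ι) (hz : ∀ i, z i ∈ I) : ∃ m ∈ I, ∀ i, z i ≠ m →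
      ∃ n ∈ I, T.Adj m n ∧ n ∈ compOn T (I \ {m}) (z i) ∧
        ∀ j, j ≠ i → n ∉ compOn T (I \ {m}) (z j) := by
  have hmin : ∀ i j, ∃ M ⊆ I, Minimal (fun S => ConnOn T S ∧ z i ∈ S ∧ z j ∈ S) M := fun i j =>
    hI.exists_minimal (hz i) (hz j)
  choose M hMI hM using hmin
  -- The minimal connecting sets of the three pairs meet pairwise. By minimality their common node
  -- lies in every connected set that contains two of the three nodes.
  obtain ⟨m, ⟨h1, h2⟩, h3⟩ := helly_three hT (hM 0 1).1.1 (hM 1 2).1.1 (hM 0 2).1.1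
    ⟨z 1, (hM 0 1).1.2.2, (hM 1 2).1.2.1⟩ ⟨z 2, (hM 1 2).1.2.2, (hM 0 2).1.2.2⟩
    ⟨z 0, (hM 0 1).1.2.1, (hM 0 2).1.2.1⟩
  have key : ∀ i j, i < j → m ∈ M i j := by
    intro i j hij
    fin_cases i <;> fin_cases j <;> simp at hij <;> assumption
  have key2 : ∀ i j, i < j → ∀ K, ConnOn T K → z i ∈ K → z j ∈ K → m ∈ K := by
    intro i j hij K hK hi hj
    have h := hM i j
    have hc := h.1.1.inter hT hK ⟨z i, h.1.2.1, hi⟩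
    exact (h.2 ⟨hc, ⟨h.1.2.1, hi⟩, ⟨h.1.2.2, hj⟩⟩ Set.inter_subset_left (key i j hij)).2
  have key3 : ∀ i j, i ≠ j → ∀ K, ConnOn T K → z i ∈ K → z j ∈ K → m ∈ K := by
    intro i j hij K hK hi hj
    rcases lt_or_gt_of_ne hij with h | h
    · exact key2 i j h K hK hi hj
    · exact key2 j i h K hK hj hi
  refine ⟨m, hMI 0 1 h1, fun i him => ?_⟩
  have hiU : z i ∈ I \ {m} := ⟨hz i, him⟩
  obtain ⟨n, hn, b, hb, hb', hnb⟩ := hI.exists_adj_compOn (U := I \ {m}) Set.sdiff_subset hiU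
    (hMI 0 1 h1) fun h => h.2 rfl
  have hbm : b = m := by
    by_contra h; exact hb' ⟨hb, h⟩
  subst hbm
  refine ⟨n, (compOn_subset hn).1, hnb.symm, hn, fun j hji hn' => ?_⟩
  have h4 := mem_compOn_trans hn' (mem_compOn_symm hn)
  have hjU : z j ∈ I \ {b} := by
    obtain ⟨K, hK, -, h, -⟩ := h4
    exact hK h
  exact (compOn_subset (key3 j i hji _ (connOn_compOn hjU) (mem_compOn_self hjU) h4)).2 rfl

/-- Each leg gives an exit node `z i` of `I`; these are distinct, since a bag has no room for `M`,
`N` and two legs. Their median `m` has three distinct neighbours, one per leg: towards `z i`, or the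
outer node `z' i` if `z i = m`. A hub with a single vertex in `bag m` and present at all three
neighbours gives a vertex whose path branches at `m`. -/
lemma not_theta [Finite ι] {M N : Set V} {A B : Fin 3 → Set V} (hM : ConnOn G M)
    (hN : ConnOn G N) (hA : ∀ i, ConnOn G (A i)) (hB : ∀ i, ConnOn G (B i)) (hMN : Disjoint M N)
    (hMA : ∀ i, Disjoint M (A i)) (hMB : ∀ i, Disjoint M (B i)) (hNA : ∀ i, Disjoint N (A i))
    (hNB : ∀ i, Disjoint N (B i)) (hAB : ∀ i, Disjoint (A i) (B i))
    (hPP : ∀ i j, i ≠ j → Disjoint (A i ∪ B i) (A j ∪ B j))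
    (aMA : ∀ i, ∃ x ∈ M, ∃ y ∈ A i, G.Adj x y) (aAB : ∀ i, ∃ x ∈ A i, ∃ y ∈ B i, G.Adj x y)
    (aBN : ∀ i, ∃ x ∈ B i, ∃ y ∈ N, G.Adj x y) : False := by
  have hT := hI.isTree.isAcyclic
  have hP : ∀ i, ConnOn G (A i ∪ B i) := fun i =>
    let ⟨x, hx, y, hy, hxy⟩ := aAB i; (hA i).union_adj (hB i) hx hy hxy
  have hMP : ∀ i, Disjoint M (A i ∪ B i) := fun i => Set.disjoint_union_right.2 ⟨hMA i, hMB i⟩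
  have hNP : ∀ i, Disjoint N (A i ∪ B i) := fun i => Set.disjoint_union_right.2 ⟨hNA i, hNB i⟩
  have nMN : (nodesOf bag M ∩ nodesOf bag N).Nonempty :=
    hI.nodesOf_inter_nonempty_of_theta hM hN hP hMP hPP
      (fun i => let ⟨x, hx, y, hy, hxy⟩ := aMA i; hI.nodesOf_inter_nonempty hx (.inl hy) hxy)
      (fun i => let ⟨x, hx, y, hy, hxy⟩ := aBN i; hI.nodesOf_inter_nonempty hy (.inr hx) hxy.symm)
  have hex : ∀ i, ∃ z ∈ nodesOf bag M ∩ nodesOf bag N, z ∈ nodesOf bag (A i ∪ B i) ∧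
      ∃ z', D.toSimpleGraphInclusive.Adj z z' ∧
        (z' ∈ nodesOf bag M ∧ z' ∉ nodesOf bag N ∨ z' ∈ nodesOf bag N ∧ z' ∉ nodesOf bag M) := by
    intro i
    obtain ⟨x, hx, y, hy, hxy⟩ := aMA i
    obtain ⟨x', hx', y', hy', hxy'⟩ := aAB i
    obtain ⟨x'', hx'', y'', hy'', hxy''⟩ := aBN i
    exact hI.exists_exit_of_path hM hN (hA i) (hB i) hMN (hMA i) (hMB i) (hNA i) (hNB i) (hAB i) nMN
      (hI.nodesOf_inter_nonempty hx hy hxy) (hI.nodesOf_inter_nonempty hx' hy' hxy')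
      (hI.nodesOf_inter_nonempty hx'' hy'' hxy'')
  choose z hzI hzP z' hzz' hz' using hex
  set I := nodesOf bag M ∩ nodesOf bag N with hIdef
  have hIc : ConnOn D.toSimpleGraphInclusive I :=
    (hI.connOn_nodesOf hM).inter hT (hI.connOn_nodesOf hN) nMN
  obtain ⟨m, hm, hmn⟩ := exists_median hT hIc z hzI
  have hz'I : ∀ i, z' i ∉ I := by
    rintro i ⟨h1, h2⟩
    rcases hz' i with h | h
    exacts [h.2 h2, h.2 h1]
  have hzinj : ∀ i j, z i = z j → i = j := by
    intro i j hij
    by_contra hne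
    exact hI.not_mem_nodesOf hMN (hMP i) (hMP j) (hNP i) (hNP j) (hPP i j hne) (hzI i).1 (hzI i).2
      (hzP i) (hij ▸ hzP j)
  have hn : ∀ i, ∃ n, D.toSimpleGraphInclusive.Adj m n ∧ (z i = m → n = z' i) ∧
      (z i ≠ m → n ∈ I ∧ n ∈ compOn D.toSimpleGraphInclusive (I \ {m}) (z i) ∧
        ∀ j, j ≠ i → n ∉ compOn D.toSimpleGraphInclusive (I \ {m}) (z j)) := by
    intro i
    by_cases h : z i = m
    · exact ⟨z' i, h ▸ hzz' i, fun _ => rfl, fun h' => absurd h h'⟩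
    · obtain ⟨n, h1, h2, h3⟩ := hmn i h
      exact ⟨n, h2, fun h' => absurd h' h, fun _ => ⟨h1, h3⟩⟩
  choose n hadj hn1 hn2 using hn
  have hinj : Function.Injective n := by
    intro i j hij
    by_contra hne
    by_cases hi : z i = m
    · have hj : z j ≠ m := fun h => hne (hzinj i j (hi.trans h.symm))
      exact hz'I i (hn1 i hi ▸ hij ▸ (hn2 j hj).1)
    · by_cases hj : z j = m
      · exact hz'I j (hn1 j hj ▸ hij ▸ (hn2 i hi).1)
      · exact (hn2 i hi).2.2 j (Ne.symm hne) (hij ▸ (hn2 j hj).2.1)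
  have fin : ∀ C : Set V, ConnOn G C → m ∈ nodesOf bag C → (∀ i, n i ∈ nodesOf bag C) →
      (∀ u ∈ C, ∀ v ∈ C, u ∈ bag m → v ∈ bag m → u = v) → False := by
    intro C hC hmC hnC h1
    obtain ⟨a, -, ha, ha'⟩ := hI.exists_common hC (connOn_singleton m) (by simpa using hmC)
      (by simpa using h1)
    exact not_three_neighbors (hI.inducesDirectedPath a trivial) (ha rfl) n hinj
      (fun i => ha' m rfl _ (hnC i) (hadj i)) hadj
  -- If `m` is itself an exit, its bag has one vertex of each hub, and the hub that survives at `z'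
  -- i` is chosen. Otherwise all three neighbours are in `I`, and one of the hubs has a single
  -- vertex in a bag of size three.
  by_cases hex : ∃ i, z i = m
  · obtain ⟨i, hi⟩ := hex
    have hni : ∀ j, j ≠ i → n j ∈ I := fun j hj => (hn2 j fun h => hj (hzinj j i (h.trans hi.symm))).1
    have hmP : m ∈ nodesOf bag (A i ∪ B i) := hi ▸ hzP i
    rcases hz' i with h | h
    · refine fin M hM hm.1 (fun j => ?_) fun u hu v hv => hI.eq_of_mem_bag hMN (hMP i) (hNP i) hm.2
        hmP hu hv
      by_cases hj : j = i
      · subst hj; rw [hn1 j hi]; exact h.1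
      · exact (hni j hj).1
    · refine fin N hN hm.2 (fun j => ?_) fun u hu v hv => hI.eq_of_mem_bag hMN.symm (hNP i) (hMP i)
        hm.1 hmP hu hv
      by_cases hj : j = i
      · subst hj; rw [hn1 j hi]; exact h.1
      · exact (hni j hj).2
  · push Not at hex
    by_cases h1 : ∀ u ∈ M, ∀ v ∈ M, u ∈ bag m → v ∈ bag m → u = v
    · exact fin M hM hm.1 (fun i => (hn2 i (hex i)).1.1) h1
    · push Not at h1
      obtain ⟨u, hu, v, hv, hum, hvm, huv⟩ := h1
      refine fin N hN hm.2 (fun i => (hn2 i (hex i)).1.2) fun a ha b hb ham hbm => ?_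
      exact eq_of_encard_le_three (hI.encard_le m) hum hvm ham hbm huv (hMN.ne_of_mem hu ha)
        (hMN.ne_of_mem hu hb) (hMN.ne_of_mem hv ha) (hMN.ne_of_mem hv hb)

lemma not_hasMinor_D3 [Finite ι] : ¬ HasMinor G D3 := by
  rintro ⟨B, hB, hd, ha⟩
  refine hI.not_theta (M := B 0) (N := B 1) (A := ![B 2, B 4, B 6]) (B := ![B 3, B 5, B 7])
    (hB 0) (hB 1) ?_ ?_ (hd 0 1 (by decide)) ?_ ?_ ?_ ?_ ?_ ?_ ?_ ?_ ?_
  · intro i; fin_cases i <;> exact hB _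
  · intro i; fin_cases i <;> exact hB _
  · intro i; fin_cases i <;> exact hd _ _ (by decide)
  · intro i; fin_cases i <;> exact hd _ _ (by decide)
  · intro i; fin_cases i <;> exact hd _ _ (by decide)
  · intro i; fin_cases i <;> exact hd _ _ (by decide)
  · intro i; fin_cases i <;> exact hd _ _ (by decide)
  · intro i j hij
    fin_cases i <;> fin_cases j <;> first
      | exact absurd rfl hij
      | exact Set.disjoint_union_left.2 ⟨Set.disjoint_union_right.2 ⟨hd _ _ (by decide),
          hd _ _ (by decide)⟩, Set.disjoint_union_right.2 ⟨hd _ _ (by decide), hd _ _ (by decide)⟩⟩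
  · intro i; fin_cases i <;> exact ha _ _ (by simp [D3])
  · intro i; fin_cases i <;> exact ha _ _ (by simp [D3])
  · intro i; fin_cases i <;> exact ha _ _ (by simp [D3])

end IsSpaghetti

end Theta

/-! ### Path decompositions as interval representations -/

section Intervals

variable {V ι : Type*} {G : SimpleGraph V}

/-- The subgraph of `G` induced by `A` has an interval supergraph without cliques of size more
than `k`. -/
def IntervalsOn (G : SimpleGraph V) (A : Set V) (k : ℕ∞) : Prop :=
  ∃ l r : V → ℕ, (∀ v ∈ A, l v ≤ r v) ∧ (∀ u ∈ A, ∀ v ∈ A, G.Adj u v → l u ≤ r v) ∧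
    ∀ i, {v ∈ A | l v ≤ i ∧ i ≤ r v}.encard ≤ k

/-- The directed path on `n + 1` nodes. -/
def pathDigraph (n : ℕ) : Digraph (Fin (n + 1)) := ⟨fun i j => (i : ℕ) + 1 = j⟩

lemma pathDigraph_toSimpleGraphInclusive (n : ℕ) :
    (pathDigraph n).toSimpleGraphInclusive = SimpleGraph.pathGraph (n + 1) := by
  ext i j
  rw [toSimpleGraphInclusive_adj, SimpleGraph.pathGraph_adj]
  change i ≠ j ∧ ((i : ℕ) + 1 = j ∨ (j : ℕ) + 1 = i) ↔ _
  constructor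
  · exact fun h => h.2
  · refine fun h => ⟨?_, h⟩
    rintro rfl
    omega

lemma isTree_pathGraph (n : ℕ) : (SimpleGraph.pathGraph (n + 1)).IsTree := by
  refine ⟨SimpleGraph.pathGraph_connected n, isAcyclic_of_cuts fun u v huv => ?_⟩
  rw [SimpleGraph.pathGraph_adj] at huv
  rcases huv with h | h
  · refine ⟨Set.Iic u, Set.self_mem_Iic, by rw [Set.mem_Iic, Fin.le_def]; omega, fun a ha b hb hab => ?_⟩
    rw [SimpleGraph.pathGraph_adj] at hab
    simp only [Set.mem_Iic, Fin.le_def, Fin.ext_iff] at *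
    omega
  · refine ⟨Set.Ici u, Set.self_mem_Ici, by rw [Set.mem_Ici, Fin.le_def]; omega, fun a ha b hb hab => ?_⟩
    rw [SimpleGraph.pathGraph_adj] at hab
    simp only [Set.mem_Ici, Fin.le_def, Fin.ext_iff] at *
    omega

lemma mem_of_connOn_pathGraph {n : ℕ} {S : Set (Fin n)} (hS : ConnOn (SimpleGraph.pathGraph n) S)
    {a b c : Fin n} (ha : a ∈ S) (hb : b ∈ S) (hac : a ≤ c) (hcb : c ≤ b) : c ∈ S := by
  by_contra hc
  have hac' : a < c := lt_of_le_of_ne hac (by rintro rfl; exact hc ha)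
  obtain ⟨u, hu, hu', v, hv, hv', huv⟩ := hS.exists_adj (P := {x | x < c}) ha hac' hb
    (by simpa using hcb)
  rw [SimpleGraph.pathGraph_adj] at huv
  simp only [Set.mem_ofPred_eq, Fin.lt_def] at *
  refine hc ((?_ : v = c) ▸ hv)
  rw [Fin.ext_iff]
  omega

lemma IntervalsOn.isSpaghetti [Finite V] {A : Set V} (h : IntervalsOn G A 3) :
    ∃ (n : ℕ) (bag : Fin (n + 1) → Set V), IsSpaghetti G A (pathDigraph n) bag := by
  obtain ⟨l, r, hlr, hadj, hcard⟩ := h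
  obtain ⟨N, hN⟩ := (Set.finite_range r).bddAbove
  have hN : ∀ v, r v ≤ N := fun v => hN ⟨v, rfl⟩
  refine ⟨N, fun i => {v ∈ A | l v ≤ i ∧ i ≤ r v}, ?_, ?_, fun _ => Set.sep_subset _ _,
    fun i => hcard i, ?_, ?_⟩
  · rw [pathDigraph_toSimpleGraphInclusive]; exact isTree_pathGraph N
  · intro x y h h'
    change (x : ℕ) + 1 = y at h
    change (y : ℕ) + 1 = x at h'
    omega
  · intro u hu v hv huv
    have h1 := hlr u hu
    have h2 := hlr v hv
    have h3 := hadj u hu v hv huv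
    have h4 := hadj v hv u hu huv.symm
    have h5 := hN u
    refine ⟨⟨max (l u) (l v), by omega⟩, ⟨hu, ?_⟩, hv, ?_⟩ <;> simp <;> omega
  · intro v hv
    have h1 := hlr v hv
    have h2 := hN v
    refine ⟨r v - l v, fun i => ⟨l v + i, by omega⟩, ?_, ?_, ?_⟩
    · intro i j hij
      have := Fin.mk.inj_iff.1 hij
      exact Fin.ext (by omega)
    · ext i
      constructor
      · rintro ⟨j, rfl⟩
        refine ⟨hv, ?_⟩
        simp only
        omega
      · rintro ⟨-, h3, h4⟩
        exact ⟨⟨i - l v, by omega⟩, Fin.ext (by simp only; omega)⟩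
    · intro i j
      change l v + (i : ℕ) + 1 = l v + j ↔ _
      omega

lemma IsSpaghetti.exists_decomposition {D : Digraph ι} {bag : ι → Set V}
    (hI : IsSpaghetti G Set.univ D bag) :
    ∃ I : DirectedSpaghettiTreeDecomposition G D, I.toTreeDecomposition.width ≤ 2 := by
  refine ⟨⟨⟨hI.isTree, bag, fun v => ?_, fun u v => hI.exists_adj_mem_bag u trivial v trivial,
    fun v => ⟨(hI.inducesDirectedPath v trivial).connOn, hI.isTree.isAcyclic.induce _⟩⟩, hI.asymm,
    fun v => hI.inducesDirectedPath v trivial⟩, ?_⟩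
  · obtain ⟨m, p, -, hp, -⟩ := hI.inducesDirectedPath v trivial
    exact ⟨p 0, (hp ▸ ⟨0, rfl⟩ : p 0 ∈ {x | v ∈ bag x})⟩
  · exact iSup_le fun x => tsub_le_iff_right.2 ((hI.encard_le x).trans (by norm_num))

lemma IsSpaghetti.transport {κ : Type*} {A : Set V} {D : Digraph ι} {bag : ι → Set V}
    (hI : IsSpaghetti G A D bag) (e : ι ≃ κ) :
    IsSpaghetti G A ⟨fun x y => D.Adj (e.symm x) (e.symm y)⟩ (fun x => bag (e.symm x)) := by
  refine ⟨?_, fun x y => hI.asymm _ _, fun x => hI.bag_subset _, fun x => hI.encard_le _,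
    fun u hu v hv huv => ?_, fun v hv => ?_⟩
  · refine (SimpleGraph.Iso.isTree_iff ⟨e, ?_⟩).1 hI.isTree
    intro a b
    simp [toSimpleGraphInclusive_adj]
  · obtain ⟨x, hx⟩ := hI.exists_adj_mem_bag u hu v hv huv
    exact ⟨e x, by simpa using hx⟩
  · obtain ⟨m, p, hp, hpr, hpD⟩ := hI.inducesDirectedPath v hv
    refine ⟨m, fun i => e (p i), e.injective.comp hp, ?_, fun i j => by simpa using hpD i j⟩
    ext x
    rw [Set.mem_ofPred_eq, ← Set.mem_ofPred_eq (p := fun x => v ∈ bag x), ← hpr]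
    constructor
    · rintro ⟨i, rfl⟩; exact ⟨i, by simp⟩
    · rintro ⟨i, hi⟩; exact ⟨i, by simp [hi]⟩

lemma directedSpaghettiTreewidth_le_two [Finite ι] {D : Digraph ι} {bag : ι → Set V}
    (hI : IsSpaghetti G Set.univ D bag) : directedSpaghettiTreewidth G ≤ 2 := by
  obtain ⟨I, h⟩ := (hI.transport (Finite.equivFin ι)).exists_decomposition
  exact iInf_le_of_le _ (iInf_le_of_le _ (iInf_le_of_le I h))

/-- The infimum is over values in `ℕ∞`: if every decomposition had width more than two, all widths
and hence the infimum would be at least three. -/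
lemma exists_isSpaghetti (h : directedSpaghettiTreewidth G ≤ 2) :
    ∃ (n : ℕ) (D : Digraph (Fin n)) (bag : Fin n → Set V), IsSpaghetti G Set.univ D bag := by
  by_contra hcon
  have h3 : (2 : ℕ∞) + 1 ≤ directedSpaghettiTreewidth G := by
    refine le_iInf fun n => le_iInf fun D => le_iInf fun I => Order.add_one_le_of_lt ?_
    by_contra hw
    rw [not_lt] at hw
    refine hcon ⟨n, D, I.bag, I.isTree, I.asymm, fun _ => Set.subset_univ _, fun x => ?_,
      fun u _ v _ => I.exists_adj_mem_bag u v, fun v _ => I.inducesDirectedPath v⟩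
    have h1 := (le_iSup (fun x => (I.bag x).encard - 1) x).trans hw
    exact (tsub_le_iff_right.1 h1).trans (by norm_num)
  have := h3.trans h
  norm_num at this

lemma pathwidth_le_two [Finite V] (h : IntervalsOn G Set.univ 3) : pathwidth G ≤ 2 := by
  obtain ⟨n, bag, hI⟩ := h.isSpaghetti
  obtain ⟨I, hw⟩ := hI.exists_decomposition
  have : ∃ I : TreeDecomposition G (SimpleGraph.pathGraph (n + 1)), I.width ≤ 2 := by
    rw [← pathDigraph_toSimpleGraphInclusive]
    exact ⟨_, hw⟩
  obtain ⟨J, hJ⟩ := this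
  exact iInf_le_of_le (n + 1) (iInf_le_of_le (SimpleGraph.pathGraph (n + 1))
    (iInf_le_of_le ⟨n, ⟨SimpleGraph.Iso.refl⟩⟩ (iInf_le_of_le J hJ)))

/-- The interval of a vertex runs from the first to the last node whose bag contains it; since its
nodes are connected, it is in all bags in between. -/
lemma intervalsOn_of_pathwidth_le {k : ℕ} (h : pathwidth G ≤ k) :
    IntervalsOn G Set.univ (k + 1) := by
  by_contra hcon
  have h3 : (k : ℕ∞) + 1 ≤ pathwidth G := by
    refine le_iInf fun n => le_iInf fun T => le_iInf fun ⟨m, ⟨e⟩⟩ => le_iInf fun I =>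
      Order.add_one_le_of_lt ?_
    by_contra hw
    rw [not_lt] at hw
    apply hcon
    have hne : ∀ v, {x | v ∈ I.bag x}.Nonempty := I.exists_mem_bag
    have hmin := fun v => Set.exists_min_image {x | v ∈ I.bag x} e (Set.toFinite _) (hne v)
    have hmax := fun v => Set.exists_max_image {x | v ∈ I.bag x} e (Set.toFinite _) (hne v)
    choose l hl hl' using hmin
    choose r hr hr' using hmax
    refine ⟨fun v => e (l v), fun v => e (r v), fun v _ => hl' v _ (hr v), fun u _ v _ huv => ?_,
      fun i => ?_⟩
    · obtain ⟨x, hx, hx'⟩ := I.exists_adj_mem_bag u v huv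
      exact (hl' u x hx).trans (hr' v x hx')
    · by_cases hi : i < m + 1
      · have h1 := (le_iSup (fun x => (I.bag x).encard - 1) (e.symm ⟨i, hi⟩)).trans hw
        refine le_trans (Set.encard_le_encard ?_) (tsub_le_iff_right.1 h1)
        rintro v ⟨-, hv1, hv2⟩
        have hc : ConnOn T {x | v ∈ I.bag x} := (I.isTree_induce v).connected
        have hc' := (connOn_iff_of_embedding e.toEmbedding).1 hc
        obtain ⟨x, hx, hx'⟩ := mem_of_connOn_pathGraph hc' ⟨l v, hl v, rfl⟩ ⟨r v, hr v, rfl⟩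
          (c := ⟨i, hi⟩) (Fin.le_def.2 hv1) (Fin.le_def.2 hv2)
        rw [← hx']
        simpa using hx
      · convert zero_le (α := ℕ∞)
        rw [Set.encard_eq_zero, Set.eq_empty_iff_forall_notMem]
        rintro v ⟨-, -, hv⟩
        exact hi (lt_of_le_of_lt hv (e (r v)).2)
  have := h3.trans h
  exact absurd this (by exact_mod_cast Nat.not_succ_le_self k)

lemma TwoConnected.connOn_compl (h : TwoConnected G) (v : V) : ConnOn G {v}ᶜ :=
  h.2 {v} (by simp)

lemma TwoConnected.connOn_univ (h : TwoConnected G) : ConnOn G Set.univ := by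
  have := h.2 ∅ (by simp)
  rwa [Set.compl_empty] at this

lemma exists_ne_ne (h : 3 ≤ ENat.card V) (u v : V) : ∃ w, w ≠ u ∧ w ≠ v := by
  by_contra! hcon
  have h1 : (Set.univ : Set V).encard ≤ ({u, v} : Set V).encard := Set.encard_le_encard
    fun w _ => (em (w = u)).imp_right (hcon w)
  have h2 := h1.trans (Set.encard_insert_le _ _)
  rw [Set.encard_univ, Set.encard_singleton] at h2
  have := h.trans h2
  norm_num at this

lemma TwoConnected.exists_two_neighbors (h : TwoConnected G) (v : V) :
    ∃ a b, a ≠ b ∧ G.Adj v a ∧ G.Adj v b := by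
  obtain ⟨w, hw, -⟩ := exists_ne_ne h.1 v v
  obtain ⟨u, -, hu, a, -, -, hua⟩ := h.connOn_univ.exists_adj (P := {v}) (Set.mem_univ v) rfl
    (Set.mem_univ w) hw
  obtain rfl : u = v := hu
  obtain ⟨w', hw', hw'a⟩ := exists_ne_ne h.1 u a
  obtain ⟨u', -, hu', b, hb, -, hub⟩ := (h.connOn_compl a).exists_adj (P := {u}) (a := u)
    (by simpa using hua.ne) rfl (b := w') (by simpa using hw'a) hw'
  obtain rfl : u' = u := hu'
  exact ⟨a, b, fun h => hb h.symm, hua, hub⟩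

/-- At the right end of the interval that ends first, all its neighbours are still present, and
there are at least two of them. -/
lemma TwoConnected.not_intervalsOn [Finite V] (h : TwoConnected G) :
    ¬ IntervalsOn G Set.univ 2 := by
  rintro ⟨l, r, hlr, hadj, hcard⟩
  obtain ⟨x, -⟩ := h.connOn_univ.nonempty
  have : Nonempty V := ⟨x⟩
  obtain ⟨v, hv⟩ := Finite.exists_min r
  obtain ⟨a, b, hab, ha, hb⟩ := h.exists_two_neighbors v
  have h1 : ({v, a, b} : Set V).encard ≤ 2 := by
    refine le_trans (Set.encard_le_encard ?_) (hcard (r v))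
    rintro x (rfl | rfl | rfl)
    · exact ⟨trivial, hlr _ trivial, le_rfl⟩
    · exact ⟨trivial, hadj _ trivial _ trivial ha.symm, hv _⟩
    · exact ⟨trivial, hadj _ trivial _ trivial hb.symm, hv _⟩
  rw [Set.encard_insert_of_notMem (by simp [ha.ne, hb.ne]), Set.encard_pair hab] at h1
  norm_num at h1

lemma TwoConnected.pathwidth_eq_two [Finite V] (h : TwoConnected G)
    (hI : IntervalsOn G Set.univ 3) : pathwidth G = 2 := by
  refine le_antisymm (pathwidth_le_two hI) ?_
  by_contra hlt
  have h1 : pathwidth G ≤ (1 : ℕ) := by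
    rw [not_le] at hlt
    exact Order.le_of_lt_add_one (by convert hlt using 1; norm_num)
  have h2 := intervalsOn_of_pathwidth_le h1
  refine h.not_intervalsOn ?_
  convert h2 using 1
  norm_num

end Intervals

/-! ### Gluing decompositions along cut vertices -/

section Glue

variable {V ι κ : Type*} {G : SimpleGraph V}

/-- The disjoint union of two digraphs, with an additional arc from `x₀` to `y₀`. -/
def joinDigraph (D : Digraph ι) (E : Digraph κ) (x₀ : ι) (y₀ : κ) : Digraph (ι ⊕ κ) where
  Adj
    | .inl a, .inl b => D.Adj a b
    | .inr a, .inr b => E.Adj a b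
    | .inl a, .inr b => a = x₀ ∧ b = y₀
    | .inr _, .inl _ => False

variable {D : Digraph ι} {E : Digraph κ} {x₀ : ι} {y₀ : κ}

lemma joinDigraph_inl_inl {a b : ι} :
    (joinDigraph D E x₀ y₀).toSimpleGraphInclusive.Adj (.inl a) (.inl b) ↔
      D.toSimpleGraphInclusive.Adj a b := by
  simp [toSimpleGraphInclusive_adj, joinDigraph]

lemma joinDigraph_inr_inr {a b : κ} :
    (joinDigraph D E x₀ y₀).toSimpleGraphInclusive.Adj (.inr a) (.inr b) ↔
      E.toSimpleGraphInclusive.Adj a b := by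
  simp [toSimpleGraphInclusive_adj, joinDigraph]

lemma joinDigraph_inl_inr {a : ι} {b : κ} :
    (joinDigraph D E x₀ y₀).toSimpleGraphInclusive.Adj (.inl a) (.inr b) ↔ a = x₀ ∧ b = y₀ := by
  simp [toSimpleGraphInclusive_adj, joinDigraph]

lemma isTree_joinDigraph (hD : D.toSimpleGraphInclusive.IsTree)
    (hE : E.toSimpleGraphInclusive.IsTree) :
    (joinDigraph D E x₀ y₀).toSimpleGraphInclusive.IsTree := by
  constructor
  · rw [← connOn_univ]
    have h1 := connOn_image (G := (joinDigraph D E x₀ y₀).toSimpleGraphInclusive) Sum.inl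
      (fun _ _ => joinDigraph_inl_inl.2) (connOn_univ.2 hD.connected)
    have h2 := connOn_image (G := (joinDigraph D E x₀ y₀).toSimpleGraphInclusive) Sum.inr
      (fun _ _ => joinDigraph_inr_inr.2) (connOn_univ.2 hE.connected)
    convert h1.union_adj h2 (u := .inl x₀) (v := .inr y₀) (by simp) (by simp)
      (joinDigraph_inl_inr.2 ⟨rfl, rfl⟩)
    simp
  · refine isAcyclic_of_cuts ?_
    have hlr : ∀ a b, (joinDigraph D E x₀ y₀).toSimpleGraphInclusive.Adj (.inl a) (.inr b) →
        a = x₀ ∧ b = y₀ := fun a b => joinDigraph_inl_inr.1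
    have hrl : ∀ a b, (joinDigraph D E x₀ y₀).toSimpleGraphInclusive.Adj (.inr b) (.inl a) →
        a = x₀ ∧ b = y₀ := fun a b h => joinDigraph_inl_inr.1 h.symm
    rintro (u | u) (v | v) huv
    · rw [joinDigraph_inl_inl] at huv
      obtain ⟨P, hu, hv, hP⟩ := exists_cut hD.isAcyclic huv
      -- The whole second tree is put on the side of its attachment node `x₀`, so that the new arc
      -- does not cross the cut.
      refine ⟨{z | Sum.elim (· ∈ P) (fun _ => x₀ ∈ P) z}, hu, hv, ?_⟩
      rintro (a | a) ha (b | b) hb hab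
      · simpa using hP a ha b hb (joinDigraph_inl_inl.1 hab)
      · exact absurd ((hlr a b hab).1 ▸ ha) hb
      · exact absurd ha ((hrl b a hab).1 ▸ hb)
      · exact absurd ha hb
    · obtain ⟨rfl, rfl⟩ := hlr u v huv
      refine ⟨Set.range Sum.inl, by simp, by simp, ?_⟩
      rintro (a | a) ha (b | b) hb hab
      · simp at hb
      · simpa using hlr a b hab
      · simp at ha
      · simp at ha
    · obtain ⟨rfl, rfl⟩ := hrl v u huv
      refine ⟨Set.range Sum.inr, by simp, by simp, ?_⟩
      rintro (a | a) ha (b | b) hb hab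
      · simp at ha
      · simp at ha
      · simpa [and_comm] using hrl b a hab
      · simp at hb
    · rw [joinDigraph_inr_inr] at huv
      obtain ⟨P, hu, hv, hP⟩ := exists_cut hE.isAcyclic huv
      refine ⟨{z | Sum.elim (fun _ => y₀ ∈ P) (· ∈ P) z}, hu, hv, ?_⟩
      rintro (a | a) ha (b | b) hb hab
      · exact absurd ha hb
      · exact absurd ha ((hlr a b hab).2 ▸ hb)
      · exact absurd ((hrl b a hab).2 ▸ ha) hb
      · simpa using hP a ha b hb (joinDigraph_inr_inr.1 hab)

lemma InducesDirectedPath.inl {S : Set ι} (h : InducesDirectedPath D S) :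
    InducesDirectedPath (joinDigraph D E x₀ y₀) (Sum.inl '' S) := by
  obtain ⟨m, p, hp, rfl, hD⟩ := h
  exact ⟨m, fun i => .inl (p i), Sum.inl_injective.comp hp, Set.range_comp _ _, hD⟩

lemma InducesDirectedPath.inr {S : Set κ} (h : InducesDirectedPath E S) :
    InducesDirectedPath (joinDigraph D E x₀ y₀) (Sum.inr '' S) := by
  obtain ⟨m, p, hp, rfl, hD⟩ := h
  exact ⟨m, fun i => .inr (p i), Sum.inr_injective.comp hp, Set.range_comp _ _, hD⟩

/-- Two disjoint directed paths are concatenated by an arc from the last node of the first path to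
the first node of the second one. -/
lemma InducesDirectedPath.exists_join {S : Set ι} {S' : Set κ} (h : InducesDirectedPath D S)
    (h' : InducesDirectedPath E S') : ∃ x₀ y₀,
      InducesDirectedPath (joinDigraph D E x₀ y₀) (Sum.inl '' S ∪ Sum.inr '' S') := by
  obtain ⟨m, f, hf, rfl, hD⟩ := inducesDirectedPath_iff.1 h
  obtain ⟨n, g, hg, rfl, hE⟩ := inducesDirectedPath_iff.1 h'
  refine ⟨f m, g 0, inducesDirectedPath_iff.2
    ⟨m + 1 + n, fun i => if i ≤ m then .inl (f i) else .inr (g (i - (m + 1))), ?_, ?_, ?_⟩⟩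
  · intro i hi j hj hij
    rw [Set.mem_Iic] at hi hj
    by_cases h1 : i ≤ m <;> by_cases h2 : j ≤ m <;> simp only [h1, h2, if_true, if_false] at hij
    · exact hf h1 h2 (Sum.inl_injective hij)
    · exact absurd hij (by simp)
    · exact absurd hij (by simp)
    · have := hg (Set.mem_Iic.2 (by omega)) (Set.mem_Iic.2 (by omega)) (Sum.inr_injective hij)
      omega
  · ext x
    constructor
    · rintro ⟨i, hi, rfl⟩
      rw [Set.mem_Iic] at hi
      by_cases h1 : i ≤ m <;> simp only [h1, if_true, if_false]
      · exact .inl ⟨_, ⟨i, h1, rfl⟩, rfl⟩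
      · exact .inr ⟨_, ⟨i - (m + 1), Set.mem_Iic.2 (by omega), rfl⟩, rfl⟩
    · rintro (⟨_, ⟨i, hi, rfl⟩, rfl⟩ | ⟨_, ⟨i, hi, rfl⟩, rfl⟩) <;> rw [Set.mem_Iic] at hi
      · exact ⟨i, Set.mem_Iic.2 (by omega), by simp [hi]⟩
      · refine ⟨i + (m + 1), Set.mem_Iic.2 (by omega), ?_⟩
        beta_reduce
        rw [if_neg (by omega), Nat.add_sub_cancel]
  · intro i hi j hj
    by_cases h1 : i ≤ m <;> by_cases h2 : j ≤ m <;> simp only [h1, h2, if_true, if_false]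
    · exact hD i h1 j h2
    · change f i = f m ∧ g (j - (m + 1)) = g 0 ↔ _
      constructor
      · rintro ⟨h3, h4⟩
        have h5 := hf h1 (Set.mem_Iic.2 le_rfl) h3
        have h6 := hg (Set.mem_Iic.2 (by omega)) (Set.mem_Iic.2 (Nat.zero_le _)) h4
        omega
      · intro h3
        obtain rfl : i = m := by omega
        simp [← h3]
    · exact ⟨False.elim, fun h3 => by omega⟩
    · exact (hE (i - (m + 1)) (by omega) (j - (m + 1)) (by omega)).trans (by omega)

lemma IsSpaghetti.join {A A' : Set V} {bag : ι → Set V} {bag' : κ → Set V}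
    (h : IsSpaghetti G A D bag) (h' : IsSpaghetti G A' E bag')
    (hadj : ∀ u ∈ A, ∀ v ∈ A', G.Adj u v → v ∈ A ∨ u ∈ A')
    (hcap : ∀ v ∈ A ∩ A', InducesDirectedPath (joinDigraph D E x₀ y₀)
      (Sum.inl '' {x | v ∈ bag x} ∪ Sum.inr '' {x | v ∈ bag' x})) :
    IsSpaghetti G (A ∪ A') (joinDigraph D E x₀ y₀) (Sum.elim bag bag') := by
  refine ⟨isTree_joinDigraph h.isTree h'.isTree, ?_, ?_, ?_, ?_, ?_⟩
  · rintro (a | a) (b | b) hab hba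
    exacts [h.asymm _ _ hab hba, hba, hab, h'.asymm _ _ hab hba]
  · rintro (x | x)
    exacts [(h.bag_subset x).trans Set.subset_union_left,
      (h'.bag_subset x).trans Set.subset_union_right]
  · rintro (x | x)
    exacts [h.encard_le x, h'.encard_le x]
  · have hA : ∀ u ∈ A, ∀ v ∈ A, G.Adj u v →
        ∃ x, u ∈ Sum.elim bag bag' x ∧ v ∈ Sum.elim bag bag' x := fun u hu v hv huv =>
      let ⟨x, hx⟩ := h.exists_adj_mem_bag u hu v hv huv; ⟨.inl x, hx⟩
    have hA' : ∀ u ∈ A', ∀ v ∈ A', G.Adj u v →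
        ∃ x, u ∈ Sum.elim bag bag' x ∧ v ∈ Sum.elim bag bag' x := fun u hu v hv huv =>
      let ⟨x, hx⟩ := h'.exists_adj_mem_bag u hu v hv huv; ⟨.inr x, hx⟩
    rintro u (hu | hu) v (hv | hv) huv
    · exact hA u hu v hv huv
    · rcases hadj u hu v hv huv with h1 | h1
      exacts [hA u hu v h1 huv, hA' u h1 v hv huv]
    · rcases hadj v hv u hu huv.symm with h1 | h1
      exacts [hA u h1 v hv huv, hA' u hu v h1 huv]
    · exact hA' u hu v hv huv
  · intro v hv
    have e : {z | v ∈ Sum.elim bag bag' z} =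
        Sum.inl '' {x | v ∈ bag x} ∪ Sum.inr '' {x | v ∈ bag' x} := by
      ext (x | x) <;> simp
    rw [e]
    by_cases h1 : v ∈ A
    · by_cases h2 : v ∈ A'
      · exact hcap v ⟨h1, h2⟩
      · have : {x | v ∈ bag' x} = ∅ :=
          Set.eq_empty_of_forall_notMem fun x hx => h2 (h'.bag_subset x hx)
        rw [this, Set.image_empty, Set.union_empty]
        exact (h.inducesDirectedPath v h1).inl
    · have h2 : v ∈ A' := hv.resolve_left h1
      have : {x | v ∈ bag x} = ∅ :=
        Set.eq_empty_of_forall_notMem fun x hx => h1 (h.bag_subset x hx)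
      rw [this, Set.image_empty, Set.empty_union]
      exact (h'.inducesDirectedPath v h2).inr

/-- The subgraph induced by `A` has directed spaghetti treewidth at most two. -/
def SpaghettiOn (G : SimpleGraph V) (A : Set V) : Prop :=
  ∃ (ι : Type) (_ : Finite ι) (D : Digraph ι) (bag : ι → Set V), IsSpaghetti G A D bag

/-- Only the shared vertex has nodes in both trees, so the linking arc can be chosen to concatenate
its two paths. With no shared vertex, any arc works. -/
lemma SpaghettiOn.union {A A' : Set V} (h : SpaghettiOn G A) (h' : SpaghettiOn G A')
    (hadj : ∀ u ∈ A, ∀ v ∈ A', G.Adj u v → v ∈ A ∨ u ∈ A') (hcap : (A ∩ A').Subsingleton) :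
    SpaghettiOn G (A ∪ A') := by
  obtain ⟨ι, _, D, bag, h⟩ := h
  obtain ⟨κ, _, E, bag', h'⟩ := h'
  by_cases hne : (A ∩ A').Nonempty
  · obtain ⟨v, hv⟩ := hne
    obtain ⟨x₀, y₀, hj⟩ := (h.inducesDirectedPath v hv.1).exists_join (h'.inducesDirectedPath v hv.2)
    exact ⟨_, inferInstance, _, _, h.join h' hadj fun w hw => (hcap hv hw) ▸ hj⟩
  · obtain ⟨x₀⟩ := h.isTree.nonempty
    obtain ⟨y₀⟩ := h'.isTree.nonempty
    exact ⟨_, inferInstance, _, _, h.join h' (x₀ := x₀) (y₀ := y₀) hadj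
      fun v hv => absurd ⟨v, hv⟩ hne⟩

/-- The subgraph induced by `A` is connected and has no cut vertex. -/
def Uncuttable (G : SimpleGraph V) (A : Set V) : Prop :=
  ConnOn G A ∧ ∀ v ∈ A, (A \ {v}).Nonempty → ConnOn G (A \ {v})

lemma IntervalsOn.spaghettiOn [Finite V] {A : Set V} (h : IntervalsOn G A 3) : SpaghettiOn G A := by
  obtain ⟨n, bag, hI⟩ := h.isSpaghetti
  exact ⟨_, inferInstance, _, bag, hI⟩

/-- Induction on the size of `A`: a disconnected set splits off a component, and a set with a cut
vertex `v` splits into a component of `A \ {v}` with `v` put back, and the remainder, which also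
contains `v`. -/
lemma spaghettiOn_of_uncuttable [Finite V] (h : ∀ A, Uncuttable G A → SpaghettiOn G A)
    (A : Set V) : SpaghettiOn G A := by
  induction hn : A.ncard using Nat.strong_induction_on generalizing A with
  | _ n ih =>
  have ih' : ∀ A', A' ⊂ A → SpaghettiOn G A' := fun A' hA' =>
    ih _ (hn ▸ Set.ncard_lt_ncard hA') A' rfl
  rcases A.eq_empty_or_nonempty with rfl | ⟨a, ha⟩
  · exact IntervalsOn.spaghettiOn ⟨fun _ => 0, fun _ => 0, by simp, by simp, by simp⟩
  by_cases hA : ConnOn G A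
  · by_cases hu : Uncuttable G A
    · exact h A hu
    · have : ∃ v ∈ A, (A \ {v}).Nonempty ∧ ¬ ConnOn G (A \ {v}) := by
        by_contra! hcon
        exact hu ⟨hA, hcon⟩
      obtain ⟨v, hv, ⟨b, hb⟩, hnc⟩ := this
      set C := compOn G (A \ {v}) b with hC
      have hCA : C ⊆ A \ {v} := compOn_subset
      have hvC : v ∉ C := fun h => (hCA h).2 rfl
      have e : A = insert v C ∪ A \ C := by
        ext x
        simp only [Set.mem_union, Set.mem_insert_iff, Set.mem_sdiff]
        have := @hCA x
        constructor
        · tauto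
        · rintro ((rfl | h) | h)
          exacts [hv, (hCA h).1, h.1]
      rw [e]
      refine (ih' _ ?_).union (ih' _ ?_) ?_ ?_
      · refine ⟨Set.insert_subset hv fun x hx => (hCA hx).1, fun hs => hnc ?_⟩
        convert connOn_compOn hb
        exact Set.Subset.antisymm (fun x hx => (hs hx.1).resolve_left hx.2) hCA
      · exact ⟨Set.sdiff_subset, fun hs => (hs hb.1).2 (mem_compOn_self hb)⟩
      · rintro u (rfl | hu) w ⟨hw, hwC⟩ huw
        · exact .inr ⟨hv, hvC⟩
        · refine .inl (.inl ?_)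
          by_contra hwv
          exact hwC (mem_compOn_of_adj hu ⟨hw, hwv⟩ huw)
      · have : insert v C ∩ (A \ C) ⊆ {v} := by
          rintro x ⟨rfl | hx, hx'⟩
          exacts [rfl, absurd hx hx'.2]
        exact Set.subsingleton_singleton.anti this
  · set C := compOn G A a with hC
    have hCA : C ⊆ A := compOn_subset
    rw [← Set.union_sdiff_cancel hCA]
    refine (ih' _ ⟨hCA, fun hs => hA ?_⟩).union (ih' _ ?_) ?_ ?_
    · exact Set.Subset.antisymm hs hCA ▸ connOn_compOn ha
    · exact ⟨Set.sdiff_subset, fun hs => (hs ha).2 (mem_compOn_self ha)⟩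
    · exact fun u hu w hw huw => absurd (mem_compOn_of_adj hu hw.1 huw) hw.2
    · rw [Set.inter_sdiff_self]
      exact Set.subsingleton_empty

lemma intervalsOn_of_encard_le {A : Set V} {k : ℕ∞} (h : A.encard ≤ k) : IntervalsOn G A k :=
  ⟨fun _ => 0, fun _ => 0, by simp, by simp, fun _ =>
    (Set.encard_le_encard (Set.sep_subset _ _)).trans h⟩

lemma IsMamba.intervalsOn (h : IsMamba G) : IntervalsOn G Set.univ 3 := by
  rcases h with ⟨-, h⟩ | ⟨⟨e⟩⟩ | ⟨⟨e⟩⟩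
  · convert intervalsOn_of_pathwidth_le (k := 2) h.le using 1
    norm_num
  · refine intervalsOn_of_encard_le ?_
    rw [Set.encard_univ, ENat.card_congr e.toEquiv]
    simp; norm_num
  · refine intervalsOn_of_encard_le ?_
    rw [Set.encard_univ, ENat.card_congr e.toEquiv]
    simp

lemma IntervalsOn.of_subgraph {k : ℕ∞} {B : G.Subgraph} (h : IntervalsOn B.coe Set.univ k)
    {A : Set V} (hA : A ⊆ B.verts) (hB : ∀ u ∈ A, ∀ v ∈ A, G.Adj u v → B.Adj u v) :
    IntervalsOn G A k := by
  classical
  obtain ⟨l, r, hlr, hadj, hcard⟩ := h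
  refine ⟨fun v => if hv : v ∈ B.verts then l ⟨v, hv⟩ else 0,
    fun v => if hv : v ∈ B.verts then r ⟨v, hv⟩ else 0, ?_, ?_, ?_⟩
  · intro v hv
    simpa [hA hv] using hlr ⟨v, hA hv⟩ trivial
  · intro u hu v hv huv
    simpa [hA hu, hA hv] using hadj ⟨u, hA hu⟩ trivial ⟨v, hA hv⟩ trivial (hB u hu v hv huv)
  · intro i
    refine le_trans ?_ ((Subtype.val_injective.encard_image _).trans_le (hcard i))
    refine Set.encard_le_encard ?_
    rintro v ⟨hv, hv'⟩
    simp only [hA hv, dif_pos] at hv'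
    exact ⟨⟨v, hA hv⟩, ⟨trivial, hv'⟩, rfl⟩

lemma directedSpaghettiTreewidth_le_two_of_blocks [Finite V]
    (h : ∀ B : G.Subgraph, IsBlock G B → IsMamba B.coe) : directedSpaghettiTreewidth G ≤ 2 := by
  obtain ⟨ι, _, D, bag, hI⟩ := spaghettiOn_of_uncuttable (G := G) (fun A hA => by
    set H : G.Subgraph := (⊤ : G.Subgraph).induce A with hH
    let f : H.coe ↪g G := ⟨⟨Subtype.val, Subtype.val_injective⟩, by
      intro a b
      have ha := a.2
      have hb := b.2
      simp only [hH, SimpleGraph.Subgraph.induce_verts] at ha hb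
      simp [hH, ha, hb]⟩
    have hcoe : ∀ S, ConnOn H.coe S ↔ ConnOn G (Subtype.val '' S) := fun S =>
      connOn_iff_of_embedding f
    have hHc : H.coe.Connected := by
      rw [← connOn_univ, hcoe]
      convert hA.1
      rw [Set.image_univ]
      exact Subtype.range_coe
    have hHv : ∀ v, ¬ IsCutVertex H.coe v := by
      rintro v ⟨-, hv⟩
      apply hv
      by_cases hne : (A \ {v.1}).Nonempty
      · have := hA.2 v v.2 hne
        refine SimpleGraph.Connected.preconnected ((hcoe _).2 ?_)
        convert this
        ext x
        simp only [Set.mem_image, Set.mem_compl_iff, Set.mem_singleton_iff, Subtype.exists,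
          exists_and_right, exists_eq_right, Set.mem_sdiff, Subtype.ext_iff]
        constructor
        · rintro ⟨hx, hx'⟩; exact ⟨hx, hx'⟩
        · rintro ⟨hx, hx'⟩; exact ⟨hx, hx'⟩
      · rintro ⟨a, ha⟩
        exact absurd ⟨a.1, a.2, fun h => ha (Subtype.ext h)⟩ hne
    -- The subgraph induced by an uncuttable set lies in some block, whose intervals restrict to it.
    obtain ⟨B, hHB, hB⟩ := Set.Finite.exists_le_maximal
      (s := {H : G.Subgraph | H.coe.Connected ∧ ∀ v, ¬ IsCutVertex H.coe v}) (Set.toFinite _)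
      ⟨hHc, hHv⟩
    refine ((h B hB).intervalsOn.of_subgraph hHB.1 fun u hu v hv huv => hHB.2 ?_).spaghettiOn
    exact ⟨hu, hv, huv⟩) Set.univ
  exact directedSpaghettiTreewidth_le_two hI

end Glue

/-! ### Path decompositions with prescribed vertices in the last bag -/

section Sweep

variable {V : Type*} {G : SimpleGraph V}

/-- The subgraph induced by `S` has a path decomposition of width at most two whose last bag
contains `x` and `y`. -/
def SweepOn (G : SimpleGraph V) (S : Set V) (x y : V) : Prop :=
  x ∈ S ∧ y ∈ S ∧ ∃ (n : ℕ) (l r : V → ℕ), r x = n ∧ r y = n ∧ (∀ v ∈ S, l v ≤ r v) ∧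
    (∀ v ∈ S, r v ≤ n) ∧ (∀ u ∈ S, ∀ v ∈ S, G.Adj u v → l u ≤ r v) ∧
    ∀ i, {v ∈ S | l v ≤ i ∧ i ≤ r v}.encard ≤ 3

lemma encard_triple_le (a b c : V) : ({a, b, c} : Set V).encard ≤ 3 := by
  refine (Set.encard_insert_le _ _).trans ?_
  refine (add_le_add_left (Set.encard_insert_le _ _) 1).trans ?_
  rw [Set.encard_singleton]
  norm_num

lemma SweepOn.symm {S : Set V} {x y : V} (h : SweepOn G S x y) : SweepOn G S y x :=
  let ⟨hx, hy, n, l, r, h1, h2, h3⟩ := h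
  ⟨hy, hx, n, l, r, h2, h1, h3⟩

lemma sweepOn_pair (x y : V) : SweepOn G {x, y} x y := by
  refine ⟨by simp, by simp, 0, fun _ => 0, fun _ => 0, rfl, rfl, by simp, by simp, by simp,
    fun i => (Set.encard_le_encard (Set.sep_subset _ _)).trans ?_⟩
  simpa using encard_triple_le x x y

/-- A new last bag `{x, z, v}` is appended. Since it contains all three, any two of them may be the
ends of the longer sweep: keeping `x` and `z` hangs a vertex onto the pair, while passing to `x` and
`v` moves the front. -/
lemma SweepOn.insert_vertex {S : Set V} {x z : V} (h : SweepOn G S x z) {v : V} (hv : v ∉ S)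
    (hN : ∀ w ∈ S, G.Adj v w → w = x ∨ w = z) {p q : V} (hp : p = x ∨ p = z ∨ p = v)
    (hq : q = x ∨ q = z ∨ q = v) : SweepOn G (insert v S) p q := by
  classical
  obtain ⟨hx, hz, n, l, r, hrx, hrz, hlr, hrn, hadj, hcard⟩ := h
  have hmem : ∀ p, p = x ∨ p = z ∨ p = v → p ∈ insert v S := by
    rintro p (rfl | rfl | rfl)
    exacts [.inr hx, .inr hz, .inl rfl]
  refine ⟨hmem p hp, hmem q hq, n + 1, fun w => if w = v then n + 1 else l w,
    fun w => if w = x ∨ w = z ∨ w = v then n + 1 else r w, if_pos hp, if_pos hq, ?_, ?_, ?_, ?_⟩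
  · rintro w (rfl | hw)
    · simp
    · have h1 := hlr w hw
      have h2 := hrn w hw
      dsimp only
      rw [if_neg (by rintro rfl; exact hv hw)]
      split_ifs <;> omega
  · rintro w (rfl | hw)
    · simp
    · have h2 := hrn w hw
      dsimp only
      split_ifs <;> omega
  · rintro u hu w hw huw
    dsimp only
    rcases hu with rfl | hu
    · have : w = x ∨ w = z ∨ w = u := by
        rcases hw with rfl | hw
        · exact absurd huw (G.loopless.irrefl _)
        · exact (hN w hw huw).imp_right .inl
      rw [if_pos rfl, if_pos this]
    · rcases hw with rfl | hw
      · have h1 := hlr u hu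
        have h2 := hrn u hu
        rw [if_pos (by simp : w = x ∨ w = z ∨ w = w)]
        split_ifs <;> omega
      · have h1 := hadj u hu w hw huw
        have h2 := hrn w hw
        rw [if_neg (by rintro rfl; exact hv hu)]
        split_ifs <;> omega
  · intro i
    by_cases hi : i ≤ n
    · refine (Set.encard_le_encard ?_).trans (hcard i)
      rintro w ⟨hw, h1, h2⟩
      dsimp only at h1 h2
      rcases hw with rfl | hw
      · rw [if_pos rfl] at h1
        omega
      · rw [if_neg (by rintro rfl; exact hv hw)] at h1
        refine ⟨hw, h1, ?_⟩
        by_cases hwx : w = x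
        · rw [hwx, hrx]; exact hi
        by_cases hwz : w = z
        · rw [hwz, hrz]; exact hi
        rwa [if_neg] at h2
        rintro (h | h | rfl)
        exacts [hwx h, hwz h, hv hw]
    · refine (Set.encard_le_encard ?_).trans (encard_triple_le x z v)
      rintro w ⟨hw, -, h2⟩
      by_contra hcon
      dsimp only at h2
      have h3 : ¬ (w = x ∨ w = z ∨ w = v) := hcon
      rw [if_neg h3] at h2
      rcases hw with rfl | hw
      · exact h3 (by simp)
      · have := hrn w hw
        omega

/-- Vertices with all their neighbours among `x` and `y` are added one by one. -/
lemma SweepOn.union [Finite V] {S F : Set V} {x y : V} (h : SweepOn G S x y) (hF : Disjoint S F)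
    (hN : ∀ v ∈ F, ∀ w ∈ S ∪ F, G.Adj v w → w = x ∨ w = y) : SweepOn G (S ∪ F) x y := by
  induction F, Set.toFinite F using Set.Finite.induction_on with
  | empty => simpa using h
  | @insert v F hv _ ih =>
    rw [Set.disjoint_insert_right] at hF
    rw [Set.union_insert] at hN ⊢
    refine (ih hF.2 fun u hu w hw => hN u (.inr hu) w (.inr hw)).insert_vertex ?_
      (fun w hw => hN v (.inl rfl) w (.inr hw)) (by simp) (by simp)
    rintro (h1 | h1)
    exacts [hF.1 h1, hv h1]

lemma SweepOn.intervalsOn {S : Set V} {x y : V} (h : SweepOn G S x y) : IntervalsOn G S 3 :=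
  let ⟨_, _, _, l, r, _, _, hlr, _, hadj, hcard⟩ := h
  ⟨l, r, hlr, hadj, hcard⟩

lemma SweepOn.join {S S' : Set V} {x y : V} (h : SweepOn G S x y) (h' : SweepOn G S' x y)
    (hSS : ∀ v ∈ S, v ∈ S' → v = x ∨ v = y)
    (hadj : ∀ u ∈ S, ∀ v ∈ S', G.Adj u v → u ∈ S' ∨ v ∈ S) : IntervalsOn G (S ∪ S') 3 := by
  classical
  obtain ⟨hx, hy, n, l, r, hrx, hry, hlr, hrn, hadjS, hcard⟩ := h
  obtain ⟨hx', hy', n', l', r', hrx', hry', hlr', hrn', hadjS', hcard'⟩ := h'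
  have hr : ∀ v ∈ S, v ∈ S' → r v = n ∧ r' v = n' := by
    intro v hv hv'
    rcases hSS v hv hv' with rfl | rfl
    exacts [⟨hrx, hrx'⟩, ⟨hry, hry'⟩]
  -- The second sweep is run backwards behind the first: its node `j` becomes `n + n' + 1 - j`, so
  -- the two last nodes become `n` and `n + 1`. The intervals of shared vertices merge there.
  refine ⟨fun v => if v ∈ S then l v else n + n' + 1 - r' v,
    fun v => if v ∈ S' then n + n' + 1 - l' v else r v, ?_, ?_, ?_⟩
  · intro v hv
    dsimp only
    by_cases h1 : v ∈ S <;> by_cases h2 : v ∈ S' <;> simp only [h1, h2, if_true, if_false]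
    · have := hlr v h1
      have := hrn v h1
      have := hlr' v h2
      have := hrn' v h2
      omega
    · exact hlr v h1
    · have := hlr' v h2
      omega
    · exact absurd hv (by simp [h1, h2])
  · have hS : ∀ u ∈ S, ∀ v ∈ S, G.Adj u v → l u ≤ if v ∈ S' then n + n' + 1 - l' v else r v := by
      intro u hu v hv huv
      have h1 := hadjS u hu v hv huv
      have h2 := hrn v hv
      split_ifs with h3
      · have := hlr' v h3
        have := hrn' v h3
        omega
      · exact h1
    have hS' : ∀ u ∈ S', ∀ v ∈ S', G.Adj u v →
        (if u ∈ S then l u else n + n' + 1 - r' u) ≤ n + n' + 1 - l' v := by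
      intro u hu v hv huv
      have h1 := hadjS' v hv u hu huv.symm
      have h2 := hrn' u hu
      split_ifs with h3
      · have := hlr u h3
        have := hrn u h3
        omega
      · omega
    intro u hu v hv huv
    have h1 : (u ∈ S ∧ v ∈ S) ∨ (u ∈ S' ∧ v ∈ S') := by
      rcases hu with hu | hu <;> rcases hv with hv | hv
      · exact .inl ⟨hu, hv⟩
      · exact (hadj u hu v hv huv).elim (fun h => .inr ⟨h, hv⟩) fun h => .inl ⟨hu, h⟩
      · exact (hadj v hv u hu huv.symm).elim (fun h => .inr ⟨hu, h⟩) fun h => .inl ⟨h, hv⟩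
      · exact .inr ⟨hu, hv⟩
    rcases h1 with ⟨h1, h2⟩ | ⟨h1, h2⟩
    · simpa only [h1, if_true] using hS u h1 v h2 huv
    · simpa only [h2, if_true] using hS' u h1 v h2 huv
  · intro i
    by_cases hi : i ≤ n
    · refine (Set.encard_le_encard ?_).trans (hcard i)
      rintro v ⟨hv, h1, h2⟩
      dsimp only at h1 h2
      have hvS : v ∈ S := by
        by_contra h3
        have := hrn' v (hv.resolve_left h3)
        rw [if_neg h3] at h1
        omega
      rw [if_pos hvS] at h1
      refine ⟨hvS, h1, ?_⟩
      by_cases h3 : v ∈ S'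
      · rw [(hr v hvS h3).1]; exact hi
      · rwa [if_neg h3] at h2
    · refine (Set.encard_le_encard ?_).trans (hcard' (n + n' + 1 - i))
      rintro v ⟨hv, h1, h2⟩
      dsimp only at h1 h2
      have hvS : v ∈ S' := by
        by_contra h3
        have := hrn v (hv.resolve_right h3)
        rw [if_neg h3] at h2
        omega
      rw [if_pos hvS] at h2
      have h4 := hlr' v hvS
      have h5 := hrn' v hvS
      refine ⟨hvS, by omega, ?_⟩
      by_cases h3 : v ∈ S
      · rw [(hr v h3 hvS).2]; omega
      · rw [if_neg h3] at h1
        omega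

end Sweep

/-! ### Building the three minors from branch sets -/

section Minors

variable {V : Type*} {G : SimpleGraph V}

/-- There is an edge between `A` and `B`. -/
def Touch (G : SimpleGraph V) (A B : Set V) : Prop := ∃ x ∈ A, ∃ y ∈ B, G.Adj x y

lemma Touch.symm {A B : Set V} (h : Touch G A B) : Touch G B A :=
  let ⟨x, hx, y, hy, hxy⟩ := h
  ⟨y, hy, x, hx, hxy.symm⟩

lemma Touch.mono {A B A' B' : Set V} (h : Touch G A B) (hA : A ⊆ A') (hB : B ⊆ B') :
    Touch G A' B' :=
  let ⟨x, hx, y, hy, hxy⟩ := h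
  ⟨x, hA hx, y, hB hy, hxy⟩

lemma ConnOn.union_touch {A B : Set V} (hA : ConnOn G A) (hB : ConnOn G B) (h : Touch G A B) :
    ConnOn G (A ∪ B) :=
  let ⟨_, hx, _, hy, hxy⟩ := h
  hA.union_adj hB hx hy hxy

lemma hasMinor_of_lt {W : Type*} [LinearOrder W] {H : SimpleGraph W} (B : W → Set V)
    (hB : ∀ w, ConnOn G (B w)) (hd : ∀ w w', w < w' → Disjoint (B w) (B w'))
    (ha : ∀ w w', w < w' → H.Adj w w' → Touch G (B w) (B w')) : HasMinor G H := by
  refine ⟨B, hB, fun w w' h => ?_, fun w w' h => ?_⟩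
  · rcases lt_or_gt_of_ne h with h | h
    exacts [hd w w' h, (hd w' w h).symm]
  · rcases lt_or_gt_of_ne h.ne with h' | h'
    exacts [ha w w' h' h, (ha w' w h' h.symm).symm]

lemma hasMinor_K4 {A B C E : Set V} (hA : ConnOn G A) (hB : ConnOn G B) (hC : ConnOn G C)
    (hE : ConnOn G E) (dAB : Disjoint A B) (dAC : Disjoint A C) (dAE : Disjoint A E)
    (dBC : Disjoint B C) (dBE : Disjoint B E) (dCE : Disjoint C E) (tAB : Touch G A B)
    (tAC : Touch G A C) (tAE : Touch G A E) (tBC : Touch G B C) (tBE : Touch G B E)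
    (tCE : Touch G C E) : HasMinor G K4 := by
  refine hasMinor_of_lt ![A, B, C, E] ?_ ?_ ?_
  · intro w
    fin_cases w <;> assumption
  · intro w w' h
    fin_cases w <;> fin_cases w' <;> first | exact absurd h (by decide) | assumption
  · intro w w' h _
    fin_cases w <;> fin_cases w' <;> first | exact absurd h (by decide) | assumption

lemma hasMinor_S3 {A B C E F I : Set V} (hA : ConnOn G A) (hB : ConnOn G B) (hC : ConnOn G C)
    (hE : ConnOn G E) (hF : ConnOn G F) (hI : ConnOn G I) (dAB : Disjoint A B)
    (dAC : Disjoint A C) (dAE : Disjoint A E) (dAF : Disjoint A F) (dAI : Disjoint A I)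
    (dBC : Disjoint B C) (dBE : Disjoint B E) (dBF : Disjoint B F) (dBI : Disjoint B I)
    (dCE : Disjoint C E) (dCF : Disjoint C F) (dCI : Disjoint C I) (dEF : Disjoint E F)
    (dEI : Disjoint E I) (dFI : Disjoint F I) (tAB : Touch G A B) (tBC : Touch G B C)
    (tCE : Touch G C E) (tEF : Touch G E F) (tFI : Touch G F I) (tAI : Touch G A I)
    (tBE : Touch G B E) (tEI : Touch G E I) (tBI : Touch G B I) : HasMinor G S3 := by
  refine hasMinor_of_lt ![A, B, C, E, F, I] ?_ ?_ ?_
  · intro w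
    fin_cases w <;> assumption
  · intro w w' h
    fin_cases w <;> fin_cases w' <;> first | exact absurd h (by decide) | assumption
  · intro w w' h h'
    fin_cases w <;> fin_cases w' <;>
      first | exact absurd h (by decide) | assumption | exact absurd h' (by simp [S3])

/-- The set `L` contains a path of two branch sets that links `M` to `N`. -/
def ThreePath (G : SimpleGraph V) (M N L : Set V) : Prop :=
  ∃ A B, A ∪ B = L ∧ ConnOn G A ∧ ConnOn G B ∧ Disjoint A B ∧ Touch G M A ∧ Touch G A B ∧
    Touch G B N

lemma hasMinor_D3 {M N : Set V} {L : Fin 3 → Set V} (hM : ConnOn G M) (hN : ConnOn G N)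
    (dMN : Disjoint M N) (dML : ∀ i, Disjoint M (L i)) (dNL : ∀ i, Disjoint N (L i))
    (dLL : ∀ i j, i < j → Disjoint (L i) (L j)) (h : ∀ i, ThreePath G M N (L i)) :
    HasMinor G D3 := by
  choose A B hL hA hB dAB tMA tAB tBN using h
  have hAL : ∀ i, A i ⊆ L i := fun i => hL i ▸ Set.subset_union_left
  have hBL : ∀ i, B i ⊆ L i := fun i => hL i ▸ Set.subset_union_right
  refine hasMinor_of_lt ![M, N, A 0, B 0, A 1, B 1, A 2, B 2] ?_ ?_ ?_
  · intro w
    fin_cases w <;> first | assumption | exact hA _ | exact hB _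
  · have dMA := fun i => (dML i).mono_right (hAL i)
    have dMB := fun i => (dML i).mono_right (hBL i)
    have dNA := fun i => (dNL i).mono_right (hAL i)
    have dNB := fun i => (dNL i).mono_right (hBL i)
    have dAA := fun i j hij => (dLL i j hij).mono (hAL i) (hAL j)
    have dAB' := fun i j hij => (dLL i j hij).mono (hAL i) (hBL j)
    have dBA := fun i j hij => (dLL i j hij).mono (hBL i) (hAL j)
    have dBB := fun i j hij => (dLL i j hij).mono (hBL i) (hBL j)
    intro w w' h
    fin_cases w <;> fin_cases w' <;> first
      | exact absurd h (by decide)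
      | exact dMN
      | exact dMA _
      | exact dMB _
      | exact dNA _
      | exact dNB _
      | exact dAB _
      | exact dAA _ _ (by decide)
      | exact dAB' _ _ (by decide)
      | exact dBA _ _ (by decide)
      | exact dBB _ _ (by decide)
  · intro w w' h h'
    fin_cases w <;> fin_cases w' <;> first
      | exact absurd h (by decide)
      | exact tMA _
      | exact tAB _
      | exact (tBN _).symm
      | exact absurd h' (by simp [D3])

end Minors

/-! ### Connected sets that meet two sets in several vertices -/

section Dichotomy

variable {V : Type*} {G : SimpleGraph V}

/-- Two disjoint adjacent connected subsets of `C`, each of which meets both `X` and `Y`. -/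
def TwoBridges (G : SimpleGraph V) (C X Y : Set V) : Prop :=
  ∃ P Q, P ⊆ C ∧ Q ⊆ C ∧ ConnOn G P ∧ ConnOn G Q ∧ Disjoint P Q ∧ Touch G P Q ∧
    (P ∩ X).Nonempty ∧ (P ∩ Y).Nonempty ∧ (Q ∩ X).Nonempty ∧ (Q ∩ Y).Nonempty

/-- A chain of three connected subsets of `C`: the middle one meets `X` and `Y`, the outer ones
meet `X` and `Y`, respectively. -/
def BridgeWithEnds (G : SimpleGraph V) (C X Y : Set V) : Prop :=
  ∃ P Z Q, P ⊆ C ∧ Z ⊆ C ∧ Q ⊆ C ∧ ConnOn G P ∧ ConnOn G Z ∧ ConnOn G Q ∧ Disjoint P Z ∧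
    Disjoint P Q ∧ Disjoint Z Q ∧ Touch G P Z ∧ Touch G Z Q ∧ (P ∩ X).Nonempty ∧
    (Z ∩ X).Nonempty ∧ (Z ∩ Y).Nonempty ∧ (Q ∩ Y).Nonempty

/-- Split `P` between `x₁` and `x₂`, and let `A` be a half that touches `Q` and `B` the other one.
If `y₁ ∈ A`, then `B`, `A`, `Q` is a chain; if `y₁ ∈ B`, then `B` and `A ∪ Q` are two bridges. -/
lemma bridges_of_split {C X Y P Q : Set V} (hP : ConnOn G P) (hQ : ConnOn G Q) (hPC : P ⊆ C)
    (hQC : Q ⊆ C) (hPQ : Disjoint P Q) (ht : Touch G P Q) {x₁ x₂ y₁ y₂ : V} (hx₁ : x₁ ∈ P ∩ X)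
    (hx₂ : x₂ ∈ P ∩ X) (hx : x₁ ≠ x₂) (hy₁ : y₁ ∈ P ∩ Y) (hy₂ : y₂ ∈ Q ∩ Y) :
    TwoBridges G C X Y ∨ BridgeWithEnds G C X Y := by
  obtain ⟨A, B, hA, hB, hxA, hxB, hAB, hABP, htAB⟩ := hP.exists_split (connOn_singleton x₁)
    (connOn_singleton x₂) (by simpa using hx₁.1) (by simpa using hx₂.1) (by simpa using hx)
  rw [Set.singleton_subset_iff] at hxA hxB
  have key : ∀ A B, ConnOn G A → ConnOn G B → (A ∩ X).Nonempty → (B ∩ X).Nonempty → Disjoint A B →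
      A ∪ B = P → Touch G A B → Touch G A Q → TwoBridges G C X Y ∨ BridgeWithEnds G C X Y := by
    intro A B hA hB hxA hxB hAB hABP htAB htAQ
    have hAP : A ⊆ P := hABP ▸ Set.subset_union_left
    have hBP : B ⊆ P := hABP ▸ Set.subset_union_right
    have dA := hPQ.mono_left hAP
    have dB := hPQ.mono_left hBP
    rcases (hABP.symm ▸ hy₁.1 : y₁ ∈ A ∪ B) with h | h
    · exact .inr ⟨B, A, Q, hBP.trans hPC, hAP.trans hPC, hQC, hB, hA, hQ, hAB.symm, dB, dA,
        htAB.symm, htAQ, hxB, hxA, ⟨y₁, h, hy₁.2⟩, ⟨y₂, hy₂⟩⟩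
    · exact .inl ⟨B, A ∪ Q, hBP.trans hPC, Set.union_subset (hAP.trans hPC) hQC, hB,
        hA.union_touch hQ htAQ, Set.disjoint_union_right.2 ⟨hAB.symm, dB⟩,
        htAB.symm.mono subset_rfl Set.subset_union_left, hxB, ⟨y₁, h, hy₁.2⟩,
        hxA.mono fun _ h => ⟨.inl h.1, h.2⟩, ⟨y₂, .inr hy₂.1, hy₂.2⟩⟩
  obtain ⟨u, hu, v, hv, huv⟩ := ht
  rcases (hABP.symm ▸ hu : u ∈ A ∪ B) with h | h
  · exact key A B hA hB ⟨x₁, hxA, hx₁.2⟩ ⟨x₂, hxB, hx₂.2⟩ hAB hABP htAB ⟨u, h, v, hv, huv⟩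
  · exact key B A hB hA ⟨x₂, hxB, hx₂.2⟩ ⟨x₁, hxA, hx₁.2⟩ hAB.symm (Set.union_comm A B ▸ hABP)
      (Touch.symm htAB) ⟨u, h, v, hv, huv⟩

/-- Split `C` between two vertices of `Y`. Either both halves also receive a vertex of `X`, or two
vertices of `X` fall into the same half and that half is split again. -/
lemma ConnOn.bridges {C X Y : Set V} (hC : ConnOn G C) (hX : (C ∩ X).Nontrivial)
    (hY : (C ∩ Y).Nontrivial) : TwoBridges G C X Y ∨ BridgeWithEnds G C X Y := by
  obtain ⟨x₁, hx₁, x₂, hx₂, hx⟩ := hX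
  obtain ⟨y₁, hy₁, y₂, hy₂, hy⟩ := hY
  obtain ⟨P, Q, hP, hQ, hyP, hyQ, hPQ, hPQC, ht⟩ := hC.exists_split (connOn_singleton y₁)
    (connOn_singleton y₂) (by simpa using hy₁.1) (by simpa using hy₂.1) (by simpa using hy)
  rw [Set.singleton_subset_iff] at hyP hyQ
  have hPC : P ⊆ C := hPQC ▸ Set.subset_union_left
  have hQC : Q ⊆ C := hPQC ▸ Set.subset_union_right
  rcases (hPQC.symm ▸ hx₁.1 : x₁ ∈ P ∪ Q) with h₁ | h₁ <;>
    rcases (hPQC.symm ▸ hx₂.1 : x₂ ∈ P ∪ Q) with h₂ | h₂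
  · exact bridges_of_split hP hQ hPC hQC hPQ ht ⟨h₁, hx₁.2⟩ ⟨h₂, hx₂.2⟩ hx ⟨hyP, hy₁.2⟩ ⟨hyQ, hy₂.2⟩
  · exact .inl ⟨P, Q, hPC, hQC, hP, hQ, hPQ, ht, ⟨x₁, h₁, hx₁.2⟩, ⟨y₁, hyP, hy₁.2⟩,
      ⟨x₂, h₂, hx₂.2⟩, ⟨y₂, hyQ, hy₂.2⟩⟩
  · exact .inl ⟨P, Q, hPC, hQC, hP, hQ, hPQ, ht, ⟨x₂, h₂, hx₂.2⟩, ⟨y₁, hyP, hy₁.2⟩,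
      ⟨x₁, h₁, hx₁.2⟩, ⟨y₂, hyQ, hy₂.2⟩⟩
  · exact bridges_of_split hQ hP hQC hPC hPQ.symm (Touch.symm ht) ⟨h₁, hx₁.2⟩ ⟨h₂, hx₂.2⟩ hx
      ⟨hyQ, hy₂.2⟩ ⟨hyP, hy₁.2⟩

end Dichotomy

/-! ### Components flanked by a triangle minor -/

section Flank

variable {V : Type*} {G : SimpleGraph V}

/-- The connected set `C` is attached to the rest of the graph at `x` and `y`, and there is a
triangle minor outside of `C` with `x` and `y` in different branch sets. -/
structure Flank (G : SimpleGraph V) (C : Set V) (x y : V) (M N W : Set V) : Prop where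
  connOn : ConnOn G C
  attach : ∀ u ∈ C, ∀ v, G.Adj u v → v ∈ C ∨ v = x ∨ v = y
  connOn_left : ConnOn G M
  connOn_right : ConnOn G N
  connOn_third : ConnOn G W
  mem_left : x ∈ M
  mem_right : y ∈ N
  disj_left : Disjoint C M
  disj_right : Disjoint C N
  disj_third : Disjoint C W
  disj_left_right : Disjoint M N
  disj_left_third : Disjoint M W
  disj_right_third : Disjoint N W
  left_right : Touch G M N
  left_third : Touch G M W
  right_third : Touch G N W

lemma Flank.symm {C M N W : Set V} {x y : V} (h : Flank G C x y M N W) : Flank G C y x N M W :=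
  ⟨h.1, fun u hu v huv => (h.2 u hu v huv).imp_right Or.symm, h.4, h.3, h.5, h.7, h.6, h.9, h.8,
    h.10, h.11.symm, h.13, h.12, h.14.symm, h.16, h.15⟩

/-- Apply `ConnOn.bridges` to the neighbourhoods of `x` and `y`. Two bridges together with `M`, `N`
form `K4`. A chain `P`, `Z`, `Q` gives `S3` with triangle `M`, `N`, `Z` and outer sets `P`, `W`,
`Q`. -/
lemma Flank.subsingleton {C M N W : Set V} {x y : V} (h : Flank G C x y M N W)
    (hK4 : ¬ HasMinor G K4) (hS3 : ¬ HasMinor G S3) :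
    (C ∩ {u | G.Adj x u}).Subsingleton ∨ (C ∩ {u | G.Adj y u}).Subsingleton := by
  by_contra! hcon
  obtain ⟨hX, hY⟩ := hcon
  have tM : ∀ P, (P ∩ {u | G.Adj x u}).Nonempty → Touch G M P := fun P ⟨u, hu, hxu⟩ =>
    ⟨x, h.mem_left, u, hu, hxu⟩
  have tN : ∀ P, (P ∩ {u | G.Adj y u}).Nonempty → Touch G N P := fun P ⟨u, hu, hxu⟩ =>
    ⟨y, h.mem_right, u, hu, hxu⟩
  have dM : ∀ P ⊆ C, Disjoint M P := fun P hP => (h.disj_left.mono_left hP).symm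
  have dN : ∀ P ⊆ C, Disjoint N P := fun P hP => (h.disj_right.mono_left hP).symm
  have dW : ∀ P ⊆ C, Disjoint P W := fun P hP => h.disj_third.mono_left hP
  rcases h.connOn.bridges hX hY with
    ⟨P, Q, hPC, hQC, hP, hQ, hPQ, ht, hPX, hPY, hQX, hQY⟩ |
    ⟨P, Z, Q, hPC, hZC, hQC, hP, hZ, hQ, dPZ, dPQ, dZQ, tPZ, tZQ, hPX, hZX, hZY, hQY⟩
  · exact hK4 (hasMinor_K4 h.connOn_left h.connOn_right hP hQ h.disj_left_right (dM P hPC) (dM Q hQC)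
      (dN P hPC) (dN Q hQC) hPQ h.left_right (tM P hPX) (tM Q hQX) (tN P hPY) (tN Q hQY) ht)
  · exact hS3 (hasMinor_S3 hP h.connOn_left h.connOn_third h.connOn_right hQ hZ (dM P hPC).symm
      (dW P hPC) (dN P hPC).symm dPQ dPZ h.disj_left_third h.disj_left_right (dM Q hQC) (dM Z hZC)
      h.disj_right_third.symm (dW Q hQC).symm (dW Z hZC).symm (dN Q hQC) (dN Z hZC) dZQ.symm
      (tM P hPX).symm h.left_third h.right_third.symm (tN Q hQY) tZQ.symm tPZ h.left_right
      (tN Z hZY) (tM Z hZX))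

section TwoConn

variable (h2 : ∀ v, ConnOn G {v}ᶜ)

include h2

/-- Otherwise `q` would separate `L` from `p`. -/
lemma exists_attach {L : Set V} {p q : V} (hpq : p ≠ q) (hp : p ∉ L) (hq : q ∉ L)
    (hN : ∀ u ∈ L, ∀ v, G.Adj u v → v ∈ L ∨ v = p ∨ v = q) (hL : L.Nonempty) :
    ∃ a ∈ L, G.Adj p a := by
  obtain ⟨d, hd⟩ := hL
  obtain ⟨u, -, hu, v, hv, hvL, huv⟩ := (h2 q).exists_adj (P := L) (a := d) (b := p)
    (by rintro rfl; exact hq hd) hd (by simpa using hpq) hp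
  rcases hN u hu v huv with h | rfl | rfl
  exacts [absurd h hvL, ⟨u, hu, huv.symm⟩, absurd rfl hv]

/-- If both attachments found are the same vertex `a`, then, as `a` is not a cut vertex, another
vertex of `L` has an edge to `p` or `q`. -/
lemma exists_attach_ne {L : Set V} {p q : V} (hpq : p ≠ q) (hp : p ∉ L) (hq : q ∉ L)
    (hN : ∀ u ∈ L, ∀ v, G.Adj u v → v ∈ L ∨ v = p ∨ v = q) (hL : L.Nontrivial) :
    ∃ a ∈ L, ∃ b ∈ L, a ≠ b ∧ G.Adj p a ∧ G.Adj q b := by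
  obtain ⟨a, ha, hpa⟩ := exists_attach h2 hpq hp hq hN hL.nonempty
  obtain ⟨b, hb, hqb⟩ := exists_attach h2 hpq.symm hq hp
    (fun u hu v huv => (hN u hu v huv).imp_right Or.symm) hL.nonempty
  by_cases hab : a = b
  · subst hab
    obtain ⟨d, hd, hda⟩ := hL.exists_ne a
    obtain ⟨u, hua, hu, v, hva, hv, huv⟩ := (h2 a).exists_adj (P := L) (a := d) (b := p) hda hd
      (by rintro rfl; exact hp ha) hp
    rcases hN u hu v huv with h | rfl | rfl
    exacts [absurd h hv, ⟨u, hu, a, ha, hua, huv.symm, hqb⟩, ⟨a, ha, u, hu, Ne.symm hua, hpa, huv.symm⟩]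
  · exact ⟨a, ha, b, hb, hab, hpa, hqb⟩

lemma threePath_of_nontrivial {L M N : Set V} {p q : V} (hpq : p ≠ q) (hp : p ∉ L) (hq : q ∉ L)
    (hN : ∀ u ∈ L, ∀ v, G.Adj u v → v ∈ L ∨ v = p ∨ v = q) (hLc : ConnOn G L)
    (hL : L.Nontrivial) (hpM : p ∈ M) (hqN : q ∈ N) : ThreePath G M N L := by
  obtain ⟨a, ha, b, hb, hab, hpa, hqb⟩ := exists_attach_ne h2 hpq hp hq hN hL
  obtain ⟨A, B, hA, hB, haA, hbB, hAB, hABL, ht⟩ := hLc.exists_split (connOn_singleton a)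
    (connOn_singleton b) (by simpa using ha) (by simpa using hb) (by simpa using hab)
  rw [Set.singleton_subset_iff] at haA hbB
  exact ⟨A, B, hABL, hA, hB, hAB, ⟨p, hpM, a, haA, hpa⟩, ht, ⟨b, hbB, q, hqN, hqb.symm⟩⟩

end TwoConn

lemma not_adj_of_not_nontrivial {U : Set V} {v : V} (hv : v ∈ U)
    (h : ¬ (compOn G U v).Nontrivial) : ∀ w ∈ U, ¬ G.Adj v w := by
  intro w hw hvw
  exact h ⟨v, mem_compOn_self hv, w, mem_compOn_of_adj (mem_compOn_self hv) hw hvw, hvw.ne⟩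

lemma disjoint_compOn {U : Set V} {u v : V} (h : compOn G U u ≠ compOn G U v) :
    Disjoint (compOn G U u) (compOn G U v) := by
  rw [Set.disjoint_left]
  intro w hw hw'
  exact h (by rw [← compOn_eq_of_mem hw, compOn_eq_of_mem hw'])

/-- In a graph without cut vertices and without the three minors, a flanked set together with its
two attachment vertices has a path decomposition of width two that ends in these vertices. -/
lemma Flank.sweepOn [Finite V] (h2 : ∀ v, ConnOn G {v}ᶜ) (hK4 : ¬ HasMinor G K4)
    (hD3 : ¬ HasMinor G D3) (hS3 : ¬ HasMinor G S3) {C M N W : Set V} {x y : V}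
    (h : Flank G C x y M N W) : SweepOn G (C ∪ {x, y}) x y := by
  induction hn : C.ncard using Nat.strong_induction_on generalizing C x y M N with
  | _ n ih =>
  -- By `Flank.subsingleton` and symmetry, `y` may be assumed to have a single neighbour `z` in `C`.
  -- The components of `C \ {z}` are attached at `x` and `z` only.
  have step : ∀ x y M N, Flank G C x y M N W → (C ∩ {u | G.Adj y u}).Subsingleton →
      SweepOn G (C ∪ {x, y}) x y := by
    intro x y M N h hY
    have hxC : x ∉ C := fun hx => Set.disjoint_left.1 h.disj_left hx h.mem_left
    have hyC : y ∉ C := fun hy => Set.disjoint_left.1 h.disj_right hy h.mem_right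
    have hxy : x ≠ y := h.disj_left_right.ne_of_mem h.mem_left h.mem_right
    obtain ⟨z, hz, hyz⟩ := exists_attach h2 hxy.symm hyC hxC
      (fun u hu v huv => (h.attach u hu v huv).imp_right Or.symm) h.connOn.nonempty
    have hyz' : ∀ u ∈ C, G.Adj y u → u = z := fun u hu huy => hY ⟨hu, huy⟩ ⟨hz, hyz⟩
    have hxz : x ≠ z := by rintro rfl; exact hxC hz
    set U := C \ {z} with hU
    have hUC : U ⊆ C := Set.sdiff_subset
    have hxU : x ∉ U := fun hx => hxC hx.1
    have hzU : z ∉ U := fun hz => hz.2 rfl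
    have hcomp : ∀ d, ∀ u ∈ compOn G U d, ∀ v, G.Adj u v → v ∈ compOn G U d ∨ v = x ∨ v = z := by
      intro d u hu v huv
      have huU := compOn_subset hu
      by_cases hvz : v = z
      · exact .inr (.inr hvz)
      rcases h.attach u huU.1 v huv with hv | rfl | rfl
      · exact .inl (mem_compOn_of_adj hu ⟨hv, hvz⟩ huv)
      · exact .inr (.inl rfl)
      · exact absurd (hyz' u huU.1 huv.symm) huU.2
    -- Two nontrivial components would be two legs from `M` to `z`. The third leg of a `D3` is `W`
    -- followed by `N`, which reaches `z` through `y`.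
    have hsame : ∀ d₁ ∈ U, ∀ d₂ ∈ U, (compOn G U d₁).Nontrivial → (compOn G U d₂).Nontrivial →
        compOn G U d₁ = compOn G U d₂ := by
      intro d₁ hd₁ d₂ hd₂ hn₁ hn₂
      by_contra hne
      have hd : ∀ d A, Disjoint C A → Disjoint A (compOn G U d) := fun d A hA =>
        (hA.mono_left (compOn_subset.trans hUC)).symm
      have htp : ∀ d ∈ U, (compOn G U d).Nontrivial → ThreePath G M {z} (compOn G U d) :=
        fun d hd hn => threePath_of_nontrivial h2 hxz (fun h => hxU (compOn_subset h))
          (fun h => hzU (compOn_subset h)) (hcomp d) (connOn_compOn hd) hn h.mem_left rfl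
      have hzd : ∀ d, Disjoint {z} (compOn G U d) := fun d =>
        Set.disjoint_singleton_left.2 fun h => hzU (compOn_subset h)
      have hWN : Disjoint C (W ∪ N) := Set.disjoint_union_right.2 ⟨h.disj_third, h.disj_right⟩
      refine hD3 (hasMinor_D3 (M := M) (N := {z})
        (L := ![compOn G U d₁, compOn G U d₂, W ∪ N]) h.connOn_left (connOn_singleton z)
        (Set.disjoint_singleton_right.2 fun h' => Set.disjoint_left.1 h.disj_left hz h') ?_ ?_ ?_ ?_)
      · intro i
        fin_cases i
        exacts [hd _ _ h.disj_left, hd _ _ h.disj_left,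
          Set.disjoint_union_right.2 ⟨h.disj_left_third, h.disj_left_right⟩]
      · intro i
        fin_cases i
        exacts [hzd _, hzd _, Set.disjoint_singleton_left.2 fun h' => Set.disjoint_left.1 hWN hz h']
      · intro i j hij
        fin_cases i <;> fin_cases j <;> first
          | exact absurd hij (by decide)
          | exact disjoint_compOn hne
          | exact (hd _ _ hWN).symm
      · intro i
        fin_cases i
        exacts [htp _ hd₁ hn₁, htp _ hd₂ hn₂, ⟨W, N, rfl, h.connOn_third, h.connOn_right,
          h.disj_right_third.symm, h.left_third, h.right_third.symm, ⟨y, h.mem_right, z, rfl, hyz⟩⟩]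
    have hpick : ∃ C' ⊆ U, SweepOn G (C' ∪ {x, z}) x z ∧ ∀ v ∈ U \ C', ∀ w ∈ U, ¬ G.Adj v w := by
      by_cases hex : ∃ d ∈ U, (compOn G U d).Nontrivial
      · obtain ⟨d, hd, hdn⟩ := hex
        refine ⟨compOn G U d, compOn_subset, ?_, fun v hv => not_adj_of_not_nontrivial hv.1 fun hvn =>
          hv.2 (hsame d hd v hv.1 hdn hvn ▸ mem_compOn_self hv.1)⟩
        -- The flanking triangle is kept, with `z` absorbed into the branch set of its neighbour
        -- `y`.
        refine ih _ ?_ (M := M) (N := insert z N) ?_ rfl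
        · refine hn ▸ Set.ncard_lt_ncard ⟨compOn_subset.trans hUC, fun hs => ?_⟩
          exact hzU (compOn_subset (hs hz))
        · have hsub := (compOn_subset (G := G) (v := d)).trans hUC
          refine ⟨connOn_compOn hd, hcomp d, h.connOn_left, h.connOn_right.insert h.mem_right hyz.symm,
            h.connOn_third, h.mem_left, .inl rfl, h.disj_left.mono_left hsub,
            Set.disjoint_insert_right.2 ⟨fun h => hzU (compOn_subset h), h.disj_right.mono_left hsub⟩,
            h.disj_third.mono_left hsub,
            Set.disjoint_insert_right.2 ⟨fun h' => Set.disjoint_left.1 h.disj_left hz h',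
              h.disj_left_right⟩, h.disj_left_third,
            Set.disjoint_insert_left.2 ⟨fun h' => Set.disjoint_left.1 h.disj_third hz h',
              h.disj_right_third⟩, h.left_right.mono subset_rfl (Set.subset_insert _ _),
            h.left_third, h.right_third.mono (Set.subset_insert _ _) subset_rfl⟩
      · push Not at hex
        refine ⟨∅, Set.empty_subset _, by simpa using sweepOn_pair x z, fun v hv =>
          not_adj_of_not_nontrivial hv.1 ?_⟩
        rw [Set.not_nontrivial_iff]
        exact hex v hv.1
    obtain ⟨C', hC'U, hC', hF⟩ := hpick
    -- The isolated vertices of `U` outside `C'` are hung onto `{x, z}`; a final bag `{x, z, y}`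
    -- then moves the front from `z` to `y`.
    have h1 := hC'.union (F := U \ C') ?_ ?_
    · have e : insert y (C' ∪ {x, z} ∪ U \ C') = C ∪ {x, y} := by
        ext w
        have := @hC'U w
        simp only [hU, Set.mem_insert_iff, Set.mem_union, Set.mem_singleton_iff, Set.mem_sdiff] at *
        by_cases hwz : w = z
        · subst hwz; tauto
        · tauto
      rw [← e]
      refine h1.insert_vertex ?_ ?_ (by simp) (by simp)
      · rintro ((h3 | rfl | rfl) | h3)
        exacts [hyC (hUC (hC'U h3)), hxy rfl, hyC hz, hyC (hUC h3.1)]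
      · rintro w ((h3 | h3) | h3) hyw
        exacts [.inr (hyz' w (hUC (hC'U h3)) hyw), h3, .inr (hyz' w (hUC h3.1) hyw)]
    · rw [Set.disjoint_left]
      rintro w (h3 | rfl | rfl) h4
      exacts [h4.2 h3, hxU h4.1, hzU h4.1]
    · rintro v hv w ((h3 | h3) | h3) hvw
      exacts [absurd hvw (hF v hv w (hC'U h3)), h3, absurd hvw (hF v hv w h3.1)]
  rcases h.subsingleton hK4 hS3 with hX | hY
  · rw [Set.pair_comm]
    exact (step y x N M h.symm hX).symm
  · exact step x y M N h hY

end Flank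

/-! ### Two-connected graphs without the three minors -/

section TwoConnectedGraphs

variable {V : Type*} {G : SimpleGraph V}

/-- Here `x` stays fixed and `y` retreats to a vertex `z` of `C` next to `y`, or next to `x` if `y`
has no neighbour in `C`. One of the at most two neighbours of `z` is thereby used up, so `z` has at
most one neighbour in the rest. -/
lemma sweepOn_of_degree_le_two [Finite V] (hG : ConnOn G Set.univ)
    (hdeg : ∀ v a b c, G.Adj v a → G.Adj v b → G.Adj v c → a = b ∨ a = c ∨ b = c) {C : Set V}
    {x y : V} (hxy : x ≠ y) (hx : x ∉ C) (hy : y ∉ C)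
    (hN : ∀ u ∈ C, ∀ v, G.Adj u v → v ∈ C ∨ v = x ∨ v = y)
    (hC : (C ∩ {u | G.Adj y u}).Subsingleton) : SweepOn G (C ∪ {x, y}) x y := by
  induction hn : C.ncard using Nat.strong_induction_on generalizing C x y with
  | _ n ih =>
  have step : ∀ z ∈ C, (G.Adj y z ∨ G.Adj x z) → (∀ u ∈ C, G.Adj y u → u = z) →
      SweepOn G (C ∪ {x, y}) x y := by
    intro z hz hadj hyz
    have h1 : SweepOn G (C \ {z} ∪ {x, z}) x z := by
      refine ih _ (hn ▸ Set.ncard_sdiff_singleton_lt_of_mem hz) (fun h => hx (h ▸ hz))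
        (fun h => hx h.1) (fun h => h.2 rfl) ?_ ?_ rfl
      · intro u hu v huv
        by_cases hvz : v = z
        · exact .inr (.inr hvz)
        rcases hN u hu.1 v huv with hv | rfl | rfl
        exacts [.inl ⟨hv, hvz⟩, .inr (.inl rfl), absurd (hyz u hu.1 huv.symm) hu.2]
      · rintro a ⟨ha, hza⟩ b ⟨hb, hzb⟩
        rcases hadj with h | h
        · rcases hdeg z a b y hza hzb h.symm with h | rfl | rfl
          exacts [h, absurd ha.1 hy, absurd hb.1 hy]
        · rcases hdeg z a b x hza hzb h.symm with h | rfl | rfl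
          exacts [h, absurd ha.1 hx, absurd hb.1 hx]
    have e : insert y (C \ {z} ∪ {x, z}) = C ∪ {x, y} := by
      ext w
      simp only [Set.mem_insert_iff, Set.mem_union, Set.mem_singleton_iff, Set.mem_sdiff]
      by_cases hwz : w = z
      · subst hwz; tauto
      · tauto
    rw [← e]
    refine h1.insert_vertex ?_ ?_ (by simp) (by simp)
    · rintro (h3 | rfl | rfl)
      exacts [hy h3.1, hxy rfl, hy hz]
    · rintro w (h3 | h3) hyw
      exacts [.inr (hyz w h3.1 hyw), h3]
  rcases C.eq_empty_or_nonempty with rfl | ⟨d, hd⟩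
  · rw [Set.empty_union]; exact sweepOn_pair x y
  by_cases h1 : (C ∩ {u | G.Adj y u}).Nonempty
  · obtain ⟨z, hz, hyz⟩ := h1
    exact step z hz (.inl hyz) fun u hu hyu => hC ⟨hu, hyu⟩ ⟨hz, hyz⟩
  · obtain ⟨u, -, hu, v, -, hv, huv⟩ := hG.exists_adj (P := C) (Set.mem_univ d) hd (Set.mem_univ x) hx
    rcases hN u hu v huv with h | rfl | rfl
    · exact absurd h hv
    · exact step u hu (.inr huv.symm) fun w hw hyw => absurd ⟨w, hw, hyw⟩ h1
    · exact absurd ⟨u, hu, huv.symm⟩ h1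

/-- In a graph without `K₄` minor, two of three legs between `x` and `y` are separated by
`x` and `y`. The third leg may be an edge. -/
lemma notMem_compOn_of_legs (hK4 : ¬ HasMinor G K4) {x y a b : V} (hxy : x ≠ y)
    {A B C : Set V} (hA : ConnOn G A) (hB : ConnOn G B) (ha : a ∈ A) (hb : b ∈ B)
    (hxA : x ∉ A) (hxB : x ∉ B) (hxC : x ∉ C) (hyA : y ∉ A) (hyB : y ∉ B) (hyC : y ∉ C)
    (dAB : Disjoint A B) (dAC : Disjoint A C) (dBC : Disjoint B C) (hxa : G.Adj x a)
    (hxb : G.Adj x b) (tA : Touch G A {y}) (tB : Touch G B {y})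
    (hC : C = ∅ ∧ G.Adj x y ∨ ConnOn G C ∧ Touch G {x} C ∧ Touch G C {y}) :
    b ∉ compOn G {x, y}ᶜ a := by
  rintro ⟨K, hKU, hK, haK, hbK⟩
  -- The leg `A` grows to its component off `x`, `y` and the other legs. A connection from `a` to
  -- `b` avoiding `x` and `y` leaves it into `B` or `C`; these two legs and `{x}`, together with
  -- `{y}` joined to the remaining leg, then form `K4`.
  set U : Set V := ({x, y} ∪ B ∪ C)ᶜ with hU
  have haU : A ⊆ U := by
    rintro w hw (((rfl | rfl) | h) | h)
    exacts [hxA hw, hyA hw, Set.disjoint_left.1 dAB hw h, Set.disjoint_left.1 dAC hw h]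
  have hAU : A ⊆ compOn G U a := hA.subset_compOn haU ha (mem_compOn_self (haU ha))
  have hcU : compOn G U a ⊆ U := compOn_subset
  have hxU : Disjoint {x} (compOn G U a) := Set.disjoint_singleton_left.2 fun h =>
    hcU h (.inl (.inl (.inl rfl)))
  have hyU : Disjoint (compOn G U a) {y} := Set.disjoint_singleton_right.2 fun h =>
    hcU h (.inl (.inl (.inr rfl)))
  have hBU : Disjoint (compOn G U a) B := Set.disjoint_left.2 fun w hw h => hcU hw (.inl (.inr h))
  have hCU : Disjoint (compOn G U a) C := Set.disjoint_left.2 fun w hw h => hcU hw (.inr h)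
  have hyC' : ConnOn G (C ∪ {y}) := by
    rcases hC with ⟨rfl, -⟩ | ⟨h, -, h'⟩
    · rw [Set.empty_union]; exact connOn_singleton y
    · exact h.union_touch (connOn_singleton y) h'
  have hxC' : Touch G {x} (C ∪ {y}) := by
    rcases hC with ⟨-, h⟩ | ⟨-, h, -⟩
    · exact ⟨x, rfl, y, .inr rfl, h⟩
    · exact h.mono subset_rfl Set.subset_union_left
  have hxB' : Disjoint {x} B := Set.disjoint_singleton_left.2 hxB
  have hyB' : Disjoint B {y} := Set.disjoint_singleton_right.2 hyB
  have hxC'' : Disjoint {x} C := Set.disjoint_singleton_left.2 hxC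
  have hyC'' : Disjoint C {y} := Set.disjoint_singleton_right.2 hyC
  have hxy' : Disjoint {x} {y} := Set.disjoint_singleton.2 hxy
  have txA : Touch G {x} (compOn G U a) := ⟨x, rfl, a, hAU ha, hxa⟩
  have txB : Touch G {x} B := ⟨x, rfl, b, hb, hxb⟩
  have tAy : Touch G (compOn G U a) {y} := tA.mono hAU subset_rfl
  obtain ⟨u, -, hu, w, hwK, hw, huw⟩ := hK.exists_adj (P := compOn G U a) haK (hAU ha) hbK
    fun h => hcU h (.inl (.inr hb))
  have hwU : w ∈ {x, y} ∪ B ∪ C := by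
    by_contra h
    exact hw (mem_compOn_of_adj hu h huw)
  have hcc := connOn_compOn (G := G) (haU ha)
  rcases hwU with (h | h) | h
  · exact hKU hwK h
  · exact hK4 (hasMinor_K4 (connOn_singleton x) hcc hB hyC' hxU hxB'
      (Set.disjoint_union_right.2 ⟨hxC'', hxy'⟩) hBU (Set.disjoint_union_right.2 ⟨hCU, hyU⟩)
      (Set.disjoint_union_right.2 ⟨dBC, hyB'⟩) txA txB hxC' ⟨u, hu, w, h, huw⟩
      (tAy.mono subset_rfl Set.subset_union_right) (tB.mono subset_rfl Set.subset_union_right))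
  · rcases hC with ⟨rfl, -⟩ | ⟨hCc, hxC, hCy⟩
    · exact h
    · exact hK4 (hasMinor_K4 (connOn_singleton x) hcc hCc (hB.union_touch (connOn_singleton y) tB)
        hxU hxC'' (Set.disjoint_union_right.2 ⟨hxB', hxy'⟩) hCU
        (Set.disjoint_union_right.2 ⟨hBU, hyU⟩) (Set.disjoint_union_right.2 ⟨dBC.symm, hyC''⟩) txA
        hxC (txB.mono subset_rfl Set.subset_union_left) ⟨u, hu, w, h, huw⟩
        (tAy.mono subset_rfl Set.subset_union_right) (hCy.mono subset_rfl Set.subset_union_right))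

/-- The vertices `x` and `y` are the ends of three paths the interiors of which are in different
components of `G - {x, y}`; one of the paths may be an edge. -/
def IsThetaPair (G : SimpleGraph V) (x y : V) : Prop :=
  (G.Adj x y ∧ ∃ a ∈ ({x, y}ᶜ : Set V), ∃ b ∈ ({x, y}ᶜ : Set V), b ∉ compOn G {x, y}ᶜ a) ∨
  ∃ a ∈ ({x, y}ᶜ : Set V), ∃ b ∈ ({x, y}ᶜ : Set V), ∃ c ∈ ({x, y}ᶜ : Set V),
    b ∉ compOn G {x, y}ᶜ a ∧ c ∉ compOn G {x, y}ᶜ a ∧ c ∉ compOn G {x, y}ᶜ b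

/-- A minimal connected set `S` through `a` and `b` in `G - x` acts as a path between them. Take `y
= c` if `c` is in `S`, and otherwise a vertex of `S` to which the component of `c` outside `S` and
`x` is attached. This gives three legs from `x` to `y`, one possibly an edge. -/
lemma exists_isThetaPair [Finite V] (h2 : ∀ v, ConnOn G {v}ᶜ) (hK4 : ¬ HasMinor G K4)
    {x a b c : V} (ha : G.Adj x a) (hb : G.Adj x b) (hc : G.Adj x c) (hab : a ≠ b) (hac : a ≠ c)
    (hbc : b ≠ c) : ∃ y, x ≠ y ∧ IsThetaPair G x y := by
  have hxa : a ∈ ({x}ᶜ : Set V) := ha.ne'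
  have hxb : b ∈ ({x}ᶜ : Set V) := hb.ne'
  have hxc : c ∈ ({x}ᶜ : Set V) := hc.ne'
  obtain ⟨S, hSx, ⟨hS, haS, hbS⟩, hSmin⟩ := (h2 x).exists_minimal hxa hxb
  have hxS : x ∉ S := fun h => hSx h rfl
  have hmin : ∀ K ⊆ S, ConnOn G K → a ∈ K → b ∈ K → S ⊆ K := fun K hKS hK haK hbK =>
    hSmin ⟨hK, haK, hbK⟩ hKS
  have leg : ∀ v ∈ S, ∀ y ∈ S, v ≠ y → v ∈ S \ {y} ∧ ConnOn G (compOn G (S \ {y}) v) ∧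
      v ∈ compOn G (S \ {y}) v ∧ x ∉ compOn G (S \ {y}) v ∧ y ∉ compOn G (S \ {y}) v ∧
      Touch G (compOn G (S \ {y}) v) {y} := by
    intro v hv y hy hvy
    have hvU : v ∈ S \ {y} := ⟨hv, hvy⟩
    refine ⟨hvU, connOn_compOn hvU, mem_compOn_self hvU, fun h => hxS (compOn_subset h).1,
      fun h => (compOn_subset h).2 rfl, ?_⟩
    obtain ⟨u, hu, w, hw, hwU, huw⟩ := hS.exists_adj_compOn (U := S \ {y}) Set.sdiff_subset hvU hy
      fun h => h.2 rfl
    obtain rfl : w = y := by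
      by_contra h; exact hwU ⟨hw, h⟩
    exact ⟨u, hu, w, rfl, huw⟩
  -- By minimality of `S`, deleting any `y` other than `a` and `b` separates `a` from `b` in `S`.
  have disj : ∀ y ∈ S, a ≠ y → b ≠ y → Disjoint (compOn G (S \ {y}) a) (compOn G (S \ {y}) b) := by
    intro y hy hay hby
    refine disjoint_compOn fun h => ?_
    have hbm : b ∈ compOn G (S \ {y}) a := h ▸ mem_compOn_self ⟨hbS, hby⟩
    exact (compOn_subset (hmin _ (compOn_subset.trans Set.sdiff_subset) (leg a haS y hy hay).2.1
      (leg a haS y hy hay).2.2.1 hbm hy)).2 rfl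
  by_cases hcS : c ∈ S
  · obtain ⟨haU, hA, haA, hxA, hcA, tA⟩ := leg a haS c hcS hac
    obtain ⟨hbU, hB, hbB, hxB, hcB, tB⟩ := leg b hbS c hcS hbc
    refine ⟨c, hc.ne, .inl ⟨hc, a, by simp [hac, ha.ne'], b, by simp [hbc, hb.ne'], ?_⟩⟩
    exact notMem_compOn_of_legs hK4 hc.ne (C := ∅) hA hB haA hbB hxA hxB (Set.notMem_empty _) hcA hcB
      (Set.notMem_empty _) (disj c hcS hac hbc) (Set.disjoint_empty _) (Set.disjoint_empty _) ha hb
      tA tB (.inl ⟨rfl, hc⟩)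
  · have hcU : c ∈ {x}ᶜ \ S := ⟨hxc, hcS⟩
    obtain ⟨u, hu, y, hy, hyU, huy⟩ := (h2 x).exists_adj_compOn (U := {x}ᶜ \ S) Set.sdiff_subset hcU
      hxa fun h => h.2 haS
    have hyS : y ∈ S := by
      by_contra h; exact hyU ⟨hy, h⟩
    have hxy : x ≠ y := Ne.symm hy
    have hC := connOn_compOn hcU (G := G)
    have hcC := mem_compOn_self hcU (G := G)
    have hxC : x ∉ compOn G ({x}ᶜ \ S) c := fun h => (compOn_subset h).1 rfl
    have hyC : y ∉ compOn G ({x}ᶜ \ S) c := fun h => (compOn_subset h).2 hyS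
    have tC : Touch G (compOn G ({x}ᶜ \ S) c) {y} := ⟨u, hu, y, rfl, huy⟩
    have txC : Touch G {x} (compOn G ({x}ᶜ \ S) c) := ⟨x, rfl, c, hcC, hc⟩
    have dC : ∀ v, Disjoint (compOn G (S \ {y}) v) (compOn G ({x}ᶜ \ S) c) := fun v =>
      Set.disjoint_left.2 fun w hw hw' => (compOn_subset hw').2 (compOn_subset hw).1
    have hcy : c ≠ y := by rintro rfl; exact hcS hyS
    refine ⟨y, hxy, ?_⟩
    have one : ∀ v ∈ S, v ≠ y → G.Adj x v → G.Adj x y → IsThetaPair G x y := by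
      intro v hv hvy hxv hxy'
      obtain ⟨hvU, hA, hvA, hxA, hyA, tA⟩ := leg v hv y hyS hvy
      refine .inl ⟨hxy', v, by simp [hvy, hxv.ne'], c, by simp [hcy, hc.ne'], ?_⟩
      exact notMem_compOn_of_legs hK4 hxy (C := ∅) hA hC hvA hcC hxA hxC (Set.notMem_empty _) hyA hyC
        (Set.notMem_empty _) (dC v) (Set.disjoint_empty _) (Set.disjoint_empty _) hxv hc tA tC
        (.inl ⟨rfl, hxy'⟩)
    by_cases hay : a = y
    · exact one b hbS (hay ▸ hab.symm) hb (hay ▸ ha)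
    by_cases hby : b = y
    · exact one a haS hay ha (hby ▸ hb)
    obtain ⟨haU, hA, haA, hxA, hyA, tA⟩ := leg a haS y hyS hay
    obtain ⟨hbU, hB, hbB, hxB, hyB, tB⟩ := leg b hbS y hyS hby
    have dAB := disj y hyS hay hby
    have txA : Touch G {x} (compOn G (S \ {y}) a) := ⟨x, rfl, a, haA, ha⟩
    have txB : Touch G {x} (compOn G (S \ {y}) b) := ⟨x, rfl, b, hbB, hb⟩
    refine .inr ⟨a, by simp [hay, ha.ne'], b, by simp [hby, hb.ne'], c, by simp [hcy, hc.ne'],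
      ?_, ?_, ?_⟩
    · exact notMem_compOn_of_legs hK4 hxy hA hB haA hbB hxA hxB hxC hyA hyB hyC dAB (dC a) (dC b) ha hb
        tA tB (.inr ⟨hC, txC, tC⟩)
    · exact notMem_compOn_of_legs hK4 hxy hA hC haA hcC hxA hxC hxB hyA hyC hyB (dC a) dAB (dC b).symm
        ha hc tA tC (.inr ⟨hB, txB, tB⟩)
    · exact notMem_compOn_of_legs hK4 hxy hB hC hbB hcC hxB hxC hxA hyB hyC hyA (dC b) dAB.symm
        (dC a).symm hb hc tB tC (.inr ⟨hA, txA, tA⟩)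

/-- Each component of `G - {x, y}` is flanked by `x`, `y` and the others, hence has a sweep ending
in `{x, y}`. Single-vertex components are hung onto this pair; of the others there are at most two,
and their sweeps are joined end to end. -/
lemma intervalsOn_of_isThetaPair [Finite V] (h2 : ∀ v, ConnOn G {v}ᶜ) (hK4 : ¬ HasMinor G K4)
    (hD3 : ¬ HasMinor G D3) (hS3 : ¬ HasMinor G S3) {x y : V} (hxy : x ≠ y)
    (h : IsThetaPair G x y) : IntervalsOn G Set.univ 3 := by
  set U : Set V := {x, y}ᶜ with hU
  have hx : ∀ d, x ∉ compOn G U d := fun d h => compOn_subset h (.inl rfl)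
  have hy : ∀ d, y ∉ compOn G U d := fun d h => compOn_subset h (.inr rfl)
  have hN : ∀ d, ∀ u ∈ compOn G U d, ∀ v, G.Adj u v → v ∈ compOn G U d ∨ v = x ∨ v = y := by
    intro d u hu v huv
    by_cases hv : v ∈ U
    · exact .inl (mem_compOn_of_adj hu hv huv)
    · exact .inr (not_not.1 hv)
  have dne : ∀ d e, e ∉ compOn G U d → e ∈ U → Disjoint (compOn G U d) (compOn G U e) :=
    fun d e he heU => disjoint_compOn fun h => he (h ▸ mem_compOn_self heU)
  have tx : ∀ d ∈ U, Touch G {x} (compOn G U d) := fun d hd =>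
    let ⟨a, ha, hxa⟩ := exists_attach h2 hxy (hx d) (hy d) (hN d) ⟨d, mem_compOn_self hd⟩
    ⟨x, rfl, a, ha, hxa⟩
  have ty : ∀ d ∈ U, Touch G {y} (compOn G U d) := fun d hd =>
    let ⟨a, ha, hxa⟩ := exists_attach h2 hxy.symm (hy d) (hx d)
      (fun u hu v huv => (hN d u hu v huv).imp_right Or.symm) ⟨d, mem_compOn_self hd⟩
    ⟨y, rfl, a, ha, hxa⟩
  have dx : ∀ d, Disjoint (compOn G U d) {x} := fun d => Set.disjoint_singleton_right.2 (hx d)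
  have dy : ∀ d, Disjoint (compOn G U d) {y} := fun d => Set.disjoint_singleton_right.2 (hy d)
  have dxy : Disjoint ({x} : Set V) {y} := Set.disjoint_singleton.2 hxy
  have edge : G.Adj x y → ∀ d ∈ U, ∀ e ∈ U, e ∉ compOn G U d →
      Flank G (compOn G U d) x y {x} {y} (compOn G U e) := fun hadj d hd e he hed =>
    ⟨connOn_compOn hd, hN d, connOn_singleton x, connOn_singleton y, connOn_compOn he, rfl, rfl, dx d,
      dy d, dne d e hed he, dxy, (dx e).symm, (dy e).symm, ⟨x, rfl, y, rfl, hadj⟩, tx e he, ty e he⟩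
  have three : ∀ d ∈ U, ∀ e ∈ U, ∀ f ∈ U, e ∉ compOn G U d → f ∉ compOn G U d → f ∉ compOn G U e →
      Flank G (compOn G U d) x y ({x} ∪ compOn G U e) {y} (compOn G U f) := by
    intro d hd e he f hf hed hfd hfe
    exact ⟨connOn_compOn hd, hN d, (connOn_singleton x).union_touch (connOn_compOn he) (tx e he),
      connOn_singleton y, connOn_compOn hf, .inl rfl, rfl,
      Set.disjoint_union_right.2 ⟨dx d, dne d e hed he⟩, dy d, dne d f hfd hf,
      Set.disjoint_union_left.2 ⟨dxy, dy e⟩,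
      Set.disjoint_union_left.2 ⟨(dx f).symm, dne e f hfe hf⟩, (dy f).symm,
      (ty e he).symm.mono Set.subset_union_right subset_rfl,
      (tx f hf).mono Set.subset_union_left subset_rfl, ty f hf⟩
  -- The triangle outside a component comes from the edge `xy` and one other component, or from two
  -- other components, one of which is merged with `x`.
  have hflank : ∀ d ∈ U, ∃ M N W, Flank G (compOn G U d) x y M N W := by
    intro d hd
    rcases h with ⟨hadj, a, ha, b, hb, hab⟩ | ⟨a, ha, b, hb, c, hc, hab, hac, hbc⟩
    · by_cases h1 : a ∈ compOn G U d
      · exact ⟨_, _, _, edge hadj d hd b hb fun h => hab (compOn_eq_of_mem h1 ▸ h)⟩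
      · exact ⟨_, _, _, edge hadj d hd a ha h1⟩
    · by_cases h1 : a ∈ compOn G U d
      · rw [← hU, compOn_eq_of_mem h1] at hab hac
        exact ⟨_, _, _, three d hd b hb c hc hab hac hbc⟩
      · by_cases h3 : b ∈ compOn G U d
        · rw [← hU, compOn_eq_of_mem h3] at hbc
          exact ⟨_, _, _, three d hd a ha c hc h1 hbc hac⟩
        · exact ⟨_, _, _, three d hd a ha b hb h1 h3 hab⟩
  have hsweep : ∀ d ∈ U, SweepOn G (compOn G U d ∪ {x, y}) x y := fun d hd =>
    let ⟨_, _, _, h⟩ := hflank d hd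
    h.sweepOn h2 hK4 hD3 hS3
  have hflash : ∀ F ⊆ U, (∀ v ∈ F, ¬ (compOn G U v).Nontrivial) → ∀ S, SweepOn G S x y →
      Disjoint S F → SweepOn G (S ∪ F) x y := by
    intro F hF hF' S hS hd
    refine hS.union hd fun v hv w hw hvw => ?_
    by_cases hwU : w ∈ U
    · exact absurd hvw (not_adj_of_not_nontrivial (hF hv) (hF' v hv) w hwU)
    · exact not_not.1 hwU
  by_cases h1 : ∃ d ∈ U, (compOn G U d).Nontrivial
  swap
  · push Not at h1
    have := hflash U subset_rfl (fun v hv => by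
      rw [Set.not_nontrivial_iff]; exact h1 v hv) {x, y} (sweepOn_pair x y) disjoint_compl_right
    rw [hU, Set.union_compl_self] at this
    exact this.intervalsOn
  obtain ⟨d, hd, hdn⟩ := h1
  by_cases h3 : ∃ e ∈ U, (compOn G U e).Nontrivial ∧ e ∉ compOn G U d
  swap
  · have h4 := hflash (U \ compOn G U d) Set.sdiff_subset
      (fun v hv hvn => h3 ⟨v, hv.1, hvn, hv.2⟩) _ (hsweep d hd) (by
        rw [Set.disjoint_left]
        rintro w (h | h) h'
        exacts [h'.2 h, h'.1 h])
    convert h4.intervalsOn using 1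
    ext w
    have hw : w ∈ U ↔ w ∉ ({x, y} : Set V) := Iff.rfl
    simp only [Set.mem_union, Set.mem_sdiff, Set.mem_univ, hw]
    tauto
  obtain ⟨e, he, hen, hed⟩ := h3
  -- Three nontrivial components would be the three legs of a `D3` between `x` and `y`.
  have h4 : ∀ f ∈ U, (compOn G U f).Nontrivial → f ∈ compOn G U d ∨ f ∈ compOn G U e := by
    intro f hf hfn
    by_contra! hcon
    have tp : ∀ d ∈ U, (compOn G U d).Nontrivial → ThreePath G {x} {y} (compOn G U d) :=
      fun d hd hdn => threePath_of_nontrivial h2 hxy (hx d) (hy d) (hN d) (connOn_compOn hd) hdn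
        rfl rfl
    refine hD3 (hasMinor_D3 (M := {x}) (N := {y})
      (L := ![compOn G U d, compOn G U e, compOn G U f]) (connOn_singleton x) (connOn_singleton y)
      dxy ?_ ?_ ?_ ?_)
    · intro i
      fin_cases i
      exacts [(dx _).symm, (dx _).symm, (dx _).symm]
    · intro i
      fin_cases i
      exacts [(dy _).symm, (dy _).symm, (dy _).symm]
    · intro i j hij
      fin_cases i <;> fin_cases j <;> first
        | exact absurd hij (by decide)
        | exact dne _ _ hed he
        | exact dne _ _ hcon.1 hf
        | exact dne _ _ hcon.2 hf
    · intro i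
      fin_cases i
      exacts [tp d hd hdn, tp e he hen, tp f hf hfn]
  have dde := Set.disjoint_left.1 (dne d e hed he)
  have h5 := hflash ((U \ compOn G U d) \ compOn G U e) (fun v hv => hv.1.1)
    (fun v hv hvn => (h4 v hv.1.1 hvn).elim hv.1.2 hv.2) _ (hsweep d hd) (by
      rw [Set.disjoint_left]
      rintro w (h | h) h'
      exacts [h'.1.2 h, h'.1.1 h])
  convert h5.join (hsweep e he) ?_ ?_ using 1
  · ext w
    have hw : w ∈ U ↔ w ∉ ({x, y} : Set V) := Iff.rfl
    simp only [Set.mem_union, Set.mem_sdiff, Set.mem_univ, hw]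
    tauto
  · rintro v ((hv | hv) | hv) (hv' | hv')
    exacts [absurd hv' (dde hv), hv', hv, hv, absurd hv' hv.2, hv']
  · rintro u hu v (hv | hv) huv
    · rcases hN e v hv u huv.symm with h | h
      · exact .inl (.inl h)
      · exact .inl (.inr h)
    · exact .inr (.inl (.inr hv))

lemma TwoConnected.intervalsOn [Finite V] (h : TwoConnected G) (hK4 : ¬ HasMinor G K4)
    (hD3 : ¬ HasMinor G D3) (hS3 : ¬ HasMinor G S3) : IntervalsOn G Set.univ 3 := by
  by_cases hdeg : ∀ v a b c, G.Adj v a → G.Adj v b → G.Adj v c → a = b ∨ a = c ∨ b = c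
  · obtain ⟨x, -⟩ := h.connOn_univ.nonempty
    obtain ⟨y, -, -, hxy, -⟩ := h.exists_two_neighbors x
    have h1 := sweepOn_of_degree_le_two h.connOn_univ hdeg (C := {x, y}ᶜ) hxy.ne (by simp) (by simp)
      (fun u _ v _ => (em (v ∈ ({x, y}ᶜ : Set V))).imp_right not_not.1) ?_
    · rw [Set.compl_union_self] at h1
      exact h1.intervalsOn
    · rintro a ⟨ha, hya⟩ b ⟨hb, hyb⟩
      rcases hdeg y a b x hya hyb hxy.symm with h | rfl | rfl
      · exact h
      · exact absurd ha (by simp)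
      · exact absurd hb (by simp)
  · push Not at hdeg
    obtain ⟨x, a, b, c, ha, hb, hc, hab, hac, hbc⟩ := hdeg
    obtain ⟨y, hxy, hθ⟩ := exists_isThetaPair h.connOn_compl hK4 ha hb hc hab hac hbc
    exact intervalsOn_of_isThetaPair h.connOn_compl hK4 hD3 hS3 hxy hθ

lemma HasMinor.of_hom {W X : Type*} {G' : SimpleGraph W} {H : SimpleGraph X} (h : HasMinor G' H)
    (f : W → V) (hf : Function.Injective f) (hadj : ∀ a b, G'.Adj a b → G.Adj (f a) (f b)) :
    HasMinor G H := by
  obtain ⟨B, hB, hd, ha⟩ := h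
  refine ⟨fun w => f '' B w, fun w => connOn_image f hadj (hB w), fun w w' hw =>
    (Set.disjoint_image_iff hf).2 (hd w w' hw), fun w w' hw => ?_⟩
  obtain ⟨x, hx, y, hy, hxy⟩ := ha w w' hw
  exact ⟨f x, ⟨x, hx, rfl⟩, f y, ⟨y, hy, rfl⟩, hadj x y hxy⟩

lemma isMamba_of_not_hasMinor [Finite V] (hG : G.Connected) (hcut : ∀ v, ¬ IsCutVertex G v)
    (hK4 : ¬ HasMinor G K4) (hD3 : ¬ HasMinor G D3) (hS3 : ¬ HasMinor G S3) : IsMamba G := by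
  have := Fintype.ofFinite V
  have := hG.nonempty
  by_cases h3 : 3 ≤ Fintype.card V
  · have h3' : 3 ≤ ENat.card V := by
      rw [ENat.card_eq_coe_fintype_card]; exact_mod_cast h3
    have h2 : TwoConnected G := by
      refine ⟨h3', fun X hX => ?_⟩
      rcases X.eq_empty_or_nonempty with rfl | ⟨v, hv⟩
      · rw [Set.compl_empty]
        exact connOn_univ.2 hG
      · obtain rfl : X = {v} := by
          refine Set.eq_singleton_iff_unique_mem.2 ⟨hv, fun w hw => ?_⟩
          exact Set.encard_le_one_iff.1 hX w v hw hv
        obtain ⟨w, hw, -⟩ := exists_ne_ne h3' v v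
        have : Nonempty ({v}ᶜ : Set V) := ⟨⟨w, hw⟩⟩
        refine ⟨?_⟩
        by_contra hcon
        exact hcut v ⟨hG, hcon⟩
    exact .inl ⟨h2, h2.pathwidth_eq_two (h2.intervalsOn hK4 hD3 hS3)⟩
  · have hpos : 0 < Fintype.card V := Fintype.card_pos
    have htop : ∀ k, Fintype.card V = k → G = ⊤ → Nonempty (G ≃g SimpleGraph.completeGraph (Fin k)) := by
      rintro k hk rfl
      exact ⟨SimpleGraph.Iso.completeGraph (Fintype.equivFinOfCardEq hk)⟩
    obtain h | h : Fintype.card V = 2 ∨ Fintype.card V = 1 := by omega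
    · refine .inr (.inl (htop 2 h ?_))
      ext u v
      rw [SimpleGraph.top_adj]
      refine ⟨fun h => h.ne, fun huv => ?_⟩
      obtain ⟨a, -, ha, b, -, hb, hab⟩ := (connOn_univ.2 hG).exists_adj (P := {u}) (Set.mem_univ u) rfl
        (Set.mem_univ v) huv.symm
      obtain rfl : a = u := ha
      obtain rfl : b = v := by
        by_contra hbv
        have := Fintype.two_lt_card_iff.2 ⟨a, b, v, hab.ne, huv, hbv⟩
        omega
      exact hab
    · refine .inr (.inr (htop 1 h ?_))
      have : Subsingleton V := Fintype.card_le_one_iff_subsingleton.1 h.le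
      exact Subsingleton.elim _ _

end TwoConnectedGraphs

end GraphWidth

/-! ### The equivalence -/

theorem mainTheorem3 {V : Type*} [Finite V] (G : SimpleGraph V) :
    List.TFAE [
      GraphWidth.directedSpaghettiTreewidth G ≤ 2,
      ∀ B : G.Subgraph, GraphWidth.IsBlock G B → GraphWidth.IsMamba B.coe,
      ¬ GraphWidth.HasMinor G GraphWidth.K4 ∧ ¬ GraphWidth.HasMinor G GraphWidth.D3 ∧
        ¬ GraphWidth.HasMinor G GraphWidth.S3] := by
  tfae_have 1 → 3 := by
    intro h
    obtain ⟨n, D, bag, hI⟩ := GraphWidth.exists_isSpaghetti h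
    exact ⟨hI.not_hasMinor_K4, hI.not_hasMinor_D3, hI.not_hasMinor_S3⟩
  tfae_have 3 → 2 := by
    rintro ⟨hK4, hD3, hS3⟩ B hB
    have hm : ∀ {n : ℕ} {H : SimpleGraph (Fin n)}, GraphWidth.HasMinor B.coe H →
        GraphWidth.HasMinor G H := fun h =>
      h.of_hom Subtype.val Subtype.val_injective fun a b hab => B.adj_sub hab
    exact GraphWidth.isMamba_of_not_hasMinor hB.1.1 hB.1.2 (fun h => hK4 (hm h))
      (fun h => hD3 (hm h)) (fun h => hS3 (hm h))
  tfae_have 2 → 1 := GraphWidth.directedSpaghettiTreewidth_le_two_of_blocks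
  tfae_finish
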